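/- Let $\mathbb F$ be a field and let the index set $T$ be an additive subgroup of $\mathbb R$ (for instance $T=\mathbb Z$ or $T=\mathbb R$). A persistence module $V$ over $T$ is a functor from the ordered set $T$ to $\mathbb F$-vector spaces, with inner morphisms $v_{s,t}\colon V_s\to V_t$ for $s\le t$. We call $V$ finitely indexed if every $V_t$ is finite dimensional and there is a finite set $S\subset T$ such that $V_t=0$ unless $\min S\le t\le\max S$, $v_{s,t}$ is surjective whenever $S\cap(s,t]=\emptyset$, and $v_{s,t}$ is injective whenever $S\cap[s,t)=\emptyset$; for $T=\mathbb Z$ this means that $V$ is pointwise finite dimensional and vanishes outside a finite range of indices. Such a $V$ is a finite direct sum of interval modules $k_{[a,b]}$ with $a\le b$ in $T$; the multiset of these bars $[a,b]$ is the barcode $\mathrm{Barc}(V)$. The nestedness $\Xi(V)\in(0,\infty]$ is the minimum of $\min\{|a-c|,|b-d|\}$ over all pairs of bars $[a,b],[c,d]\in\mathrm{Barc}(V)$ with $c<a\le b<d$ (and $\infty$ if there are none). For $\delta\in T$ let $V(\delta)_t=V_{t+\delta}$. For $\delta\ge 0$, a $\delta$-interleaving of $V$ and $W$ is a pair of morphisms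 $\Phi\colon V\to W(\delta)$, $\Psi\colon W\to V(\delta)$ with $\Psi_{t+\delta}\circ\Phi_t=v_{t,t+2\delta}$ and $\Phi_{t+\delta}\circ\Psi_t=w_{t,t+2\delta}$ for all $t$; $d_I(V,W)\in[0,\infty]$ is the infimum of all $\delta\in T$ for which one exists. A ladder decomposition of a morphism $\Phi\colon V\to U$ is an isomorphism of $(V,U,\Phi)$ with a finite direct sum of elementary ladder modules: $\mathbf R_K^J$ (the morphism $k_J\to k_K$ that is the identity on $J\cap K$, where $K=[i_1,j_1]$, $J=[i_2,j_2]$ and $i_1\le i_2\le j_1\le j_2$), $\mathbf I^+_J$ (the morphism $k_J\to 0$) and $\mathbf I^-_K$ (the morphism $0\to k_K$). A ladder decomposition of $\Phi\colon V\to W(\delta)$ induces the multiset $\chi_\Phi$ that contains, for each summand $\mathbf R^J_{[i,j]}$ (counted with multiplicity), the pair $(J,[i+\delta,j+\delta])$; here $[i,j]$ is a bar of $W(\delta)$ and $[i+\delta,j+\delta]$ the corresponding bar of $W$. A partial matching of two barcodes is a multiset of pairs of bars in which each bar is used at most as often as its multiplicity. Its bottleneck cost is the maximum of the numbers $\max(|i_1-j_1|,|i_2-j_2|)$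 over the matched pairs $([i_1,i_2],[j_1,j_2])$ and $\frac12(j_2-j_1)$ over the unmatched bars $[j_1,j_2]$ of either barcode (and $0$ if there are none). The bottleneck distance is the smallest cost of a partial matching. Theorem. Let $V,W$ be finitely indexed persistence modules over $T$ and let $\Phi\colon V\to W(\delta)$ be one of the two morphisms of a $\delta$-interleaving with $\delta<\frac12\min(\Xi(V),\Xi(W))$. Then $\Phi$ has a ladder decomposition. For every ladder decomposition of $\Phi$, the induced $\chi_\Phi$ is a partial matching of $\mathrm{Barc}(V)$ and $\mathrm{Barc}(W)$, and its bottleneck cost is at most $\delta$. If moreover $T$ is dense in $\mathbb R$ (for instance $T=\mathbb R$) and $\delta=d_I(V,W)$, then the cost of $\chi_\Phi$ equals the bottleneck distance of $\mathrm{Barc}(V)$ and $\mathrm{Barc}(W)$. -/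

import Mathlib

open scoped ENNReal

universe u v w

/-! Bars and barcodes. The index set of the persistence modules is an additive subgroup `T` of `ℝ`:
`T = ℤ` gives modules indexed by integers, `T = ℝ` gives modules with a real parameter. -/

/-- A bar `[lo, hi]` with end points in the index set `T`. -/
@[ext]
structure Bar (T : AddSubgroup ℝ) where
  lo : T
  hi : T
  lo_le_hi : lo ≤ hi

/-- The index `t` lies in the bar `[lo, hi]`. -/
def Bar.Contains {T : AddSubgroup ℝ} (J : Bar T) (t : T) : Prop :=
  J.lo ≤ t ∧ t ≤ J.hi

/-- The overlapping relation `[i₁, j₁] ≼ [i₂, j₂]`, that is `i₁ ≤ i₂ ≤ j₁ ≤ j₂`. -/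
def Bar.Overlaps {T : AddSubgroup ℝ} (I J : Bar T) : Prop :=
  I.lo ≤ J.lo ∧ J.lo ≤ I.hi ∧ I.hi ≤ J.hi

/-- `I` is strictly nested in `J`: both end points of `I` are strictly inside `J`. -/
def Bar.StrictlyNested {T : AddSubgroup ℝ} (I J : Bar T) : Prop :=
  J.lo < I.lo ∧ I.hi < J.hi

/-- The translated bar `[lo + δ, hi + δ]`. -/
def Bar.translate {T : AddSubgroup ℝ} (J : Bar T) (δ : T) : Bar T where
  lo := J.lo + δ
  hi := J.hi + δ
  lo_le_hi := by
    have h := J.lo_le_hi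
    gcongr

/-! Persistence modules and their morphisms. -/

/-- A persistence module indexed by `T`: a functor from the ordered set `T` to `F`-vector spaces. -/
structure PersModule (F : Type u) [Field F] (T : AddSubgroup ℝ) where
  obj : T → Type v
  [addCommGroup : ∀ t, AddCommGroup (obj t)]
  [module : ∀ t, Module F (obj t)]
  map : ∀ {s t : T}, s ≤ t → (obj s →ₗ[F] obj t)
  map_refl : ∀ (t : T) (x : obj t), map (le_refl t) x = x
  map_map : ∀ {r s t : T} (h : r ≤ s) (k : s ≤ t) (x : obj r), map k (map h x) = map (h.trans k) x

attribute [instance] PersModule.addCommGroup PersModule.module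

namespace PersModule

variable {F : Type u} [Field F] {T : AddSubgroup ℝ}

/-- `V` is pointwise finite dimensional and of finite type with closed bars: there is a finite set
`S` of indices such that `V` vanishes outside the range of `S`, a class can be born only at an index
of `S`, and a class can be killed only on leaving an index of `S`. For `T = ℤ` this says that `V` is
pointwise finite dimensional and vanishes outside a finite range of integers. -/
def IsFinitelyIndexed (V : PersModule.{u, v} F T) : Prop :=
  (∀ t, Module.Finite F (V.obj t)) ∧
  ∃ S : Finset T,
    (∀ t, Nontrivial (V.obj t) → (∃ a ∈ S, a ≤ t) ∧ (∃ b ∈ S, t ≤ b)) ∧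
    (∀ (s t : T) (h : s ≤ t), (∀ c ∈ S, ¬ (s < c ∧ c ≤ t)) → Function.Surjective (V.map h)) ∧
    (∀ (s t : T) (h : s ≤ t), (∀ c ∈ S, ¬ (s ≤ c ∧ c < t)) → Function.Injective (V.map h))

/-- A morphism of persistence modules. -/
structure Hom (V : PersModule.{u, v} F T) (W : PersModule.{u, w} F T) where
  app : ∀ t : T, V.obj t →ₗ[F] W.obj t
  naturality : ∀ {s t : T} (h : s ≤ t) (x : V.obj s), app t (V.map h x) = W.map h (app s x)

/-- An isomorphism of persistence modules. -/
structure Iso (V : PersModule.{u, v} F T) (W : PersModule.{u, w} F T) where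
  equiv : ∀ t : T, V.obj t ≃ₗ[F] W.obj t
  naturality : ∀ {s t : T} (h : s ≤ t) (x : V.obj s), equiv t (V.map h x) = W.map h (equiv s x)

/-- The shifted module `V(δ)`, with `V(δ)_t = V_{t + δ}`. -/
def shift (V : PersModule.{u, v} F T) (δ : T) : PersModule.{u, v} F T where
  obj t := V.obj (t + δ)
  map h := V.map (add_le_add_left h δ)
  map_refl t x := V.map_refl (t + δ) x
  map_map h k x := V.map_map (add_le_add_left h δ) (add_le_add_left k δ) x

/-- The morphisms `Φ : V ⟶ W(δ)` and `Ψ : W ⟶ V(δ)` form a `δ`-interleaving: the composites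
`V_t ⟶ W_{t+δ} ⟶ V_{t+2δ}` and `W_t ⟶ V_{t+δ} ⟶ W_{t+2δ}` are the inner morphisms. -/
def IsInterleaving {V : PersModule.{u, v} F T} {W : PersModule.{u, w} F T} {δ : T}
    (Φ : Hom V (W.shift δ)) (Ψ : Hom W (V.shift δ)) : Prop :=
  ∃ hδ : 0 ≤ δ,
    (∀ (t : T) (x : V.obj t), Ψ.app (t + δ) (Φ.app t x) =
      V.map ((le_add_of_nonneg_right hδ).trans (le_add_of_nonneg_right hδ) : t ≤ t + δ + δ) x) ∧
    (∀ (t : T) (y : W.obj t), Φ.app (t + δ) (Ψ.app t y) =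
      W.map ((le_add_of_nonneg_right hδ).trans (le_add_of_nonneg_right hδ) : t ≤ t + δ + δ) y)

/-- The interleaving distance, the infimum of all `δ` such that `V` and `W` are `δ`-interleaved. -/
noncomputable def interleavingDist (V : PersModule.{u, v} F T) (W : PersModule.{u, w} F T) : ℝ≥0∞ :=
  ⨅ (δ : T) (_ : ∃ (Φ : Hom V (W.shift δ)) (Ψ : Hom W (V.shift δ)), IsInterleaving Φ Ψ),
    ENNReal.ofReal (δ : ℝ)

/-- The direct sum of a finite family of persistence modules. -/
def directSum {n : ℕ} (M : Fin n → PersModule.{u, v} F T) : PersModule.{u, v} F T where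
  obj t := ∀ i, (M i).obj t
  map h := LinearMap.pi fun i => (M i).map h ∘ₗ LinearMap.proj i
  map_refl t x := by
    ext i
    exact (M i).map_refl t (x i)
  map_map h k x := by
    ext i
    exact (M i).map_map h k (x i)

/-- The zero module. -/
def zero (F : Type u) [Field F] (T : AddSubgroup ℝ) : PersModule.{u, u} F T where
  obj _ := PUnit
  map _ := 0
  map_refl _ _ := rfl
  map_map _ _ _ := rfl

variable (F) in
/-- The value at `t` of the interval module of `J`: it is `F` if `t ∈ J`, and `0` otherwise. -/
def intervalObj (J : Bar T) (t : T) : Submodule F F where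
  carrier := {x | ¬ J.Contains t → x = 0}
  add_mem' {x y} hx hy h := by rw [hx h, hy h, add_zero]
  zero_mem' _ := rfl
  smul_mem' c x hx h := by rw [hx h, smul_zero]

open scoped Classical in
/-- The linear map from a subspace of `F` to `intervalObj F K t` that is the identity of scalars
if `t ∈ K`, and zero otherwise. -/
noncomputable def toIntervalObj (A : Submodule F F) (K : Bar T) (t : T) :
    A →ₗ[F] intervalObj F K t where
  toFun x := ⟨if K.Contains t then (x : F) else 0, fun h => if_neg h⟩
  map_add' x y := by
    apply Subtype.ext
    by_cases h : K.Contains t <;> simp [h]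
  map_smul' c x := by
    apply Subtype.ext
    by_cases h : K.Contains t <;> simp [h]

variable (F) in
/-- The interval module `k_J`: it is `F` on `J` and `0` elsewhere, and its inner morphisms are
identities inside `J` and zero otherwise. -/
noncomputable def interval (J : Bar T) : PersModule.{u, u} F T where
  obj t := intervalObj F J t
  map {s t} _ := toIntervalObj (intervalObj F J s) J t
  map_refl t x := by
    apply Subtype.ext
    by_cases h : J.Contains t
    · simp [toIntervalObj, h]
    · simp [toIntervalObj, h, x.2 h]
  map_map {r s t} h k x := by
    apply Subtype.ext
    by_cases ht : J.Contains t
    · by_cases hs : J.Contains s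
      · simp [toIntervalObj, ht, hs]
      · have hr : ¬ J.Contains r := fun hr => hs ⟨hr.1.trans h, k.trans ht.2⟩
        simp [toIntervalObj, ht, hs, x.2 hr]
    · simp [toIntervalObj, ht]

/-- `B` is a barcode of `V`: `V` is isomorphic to the direct sum of the interval modules of the
bars in `B`, with multiplicities. -/
def IsBarcode (V : PersModule.{u, v} F T) (B : Multiset (Bar T)) : Prop :=
  ∃ (n : ℕ) (J : Fin n → Bar T), (Finset.univ : Finset (Fin n)).val.map J = B ∧
    Nonempty (Iso V (directSum fun i => interval F (J i)))

open scoped Classical in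
/-- The barcode of `V`; it exists and is unique for the finitely indexed modules. -/
noncomputable def barcode (V : PersModule.{u, v} F T) : Multiset (Bar T) :=
  if h : ∃ B, IsBarcode V B then h.choose else 0

/-- The nestedness `Ξ(V)`; it is `∞` if there are no strictly nested bars. -/
noncomputable def nestedness (V : PersModule.{u, v} F T) : ℝ≥0∞ :=
  ⨅ (I ∈ V.barcode) (J ∈ V.barcode) (_ : I.StrictlyNested J),
    min (ENNReal.ofReal |(I.lo : ℝ) - J.lo|) (ENNReal.ofReal |(I.hi : ℝ) - J.hi|)

end PersModule

/-! Ladder persistence modules. -/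

/-- A ladder persistence module `(V, W, Φ)`. -/
structure Ladder (F : Type u) [Field F] (T : AddSubgroup ℝ) where
  src : PersModule.{u, v} F T
  tgt : PersModule.{u, w} F T
  hom : PersModule.Hom src tgt

/-- An isomorphism of ladder persistence modules. -/
structure Ladder.Iso {F : Type u} [Field F] {T : AddSubgroup ℝ}
    (L : Ladder.{u, v, w} F T) (M : Ladder.{u, u, u} F T) where
  src : PersModule.Iso L.src M.src
  tgt : PersModule.Iso L.tgt M.tgt
  comm : ∀ (t : T) (x : L.src.obj t),
    M.hom.app t (src.equiv t x) = tgt.equiv t (L.hom.app t x)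

/-- The direct sum of a finite family of ladder persistence modules. -/
def Ladder.directSum {F : Type u} [Field F] {T : AddSubgroup ℝ} {n : ℕ}
    (L : Fin n → Ladder.{u, v, w} F T) : Ladder.{u, v, w} F T where
  src := PersModule.directSum fun i => (L i).src
  tgt := PersModule.directSum fun i => (L i).tgt
  hom :=
    { app := fun t => LinearMap.pi fun i => (L i).hom.app t ∘ₗ LinearMap.proj i
      naturality := by
        intro s t h x
        funext i
        exact (L i).hom.naturality h (x i) }

/-- The names of the elementary ladder persistence modules: `R J K` stands for the module with the
interval `J` on the source side, mapped to the interval `K ≼ J` on the target side; `plus J` has the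
interval `J` on the source side only, `minus K` has the interval `K` on the target side only. -/
inductive ElementaryLadder (T : AddSubgroup ℝ) where
  | R (J K : Bar T) (h : K.Overlaps J) : ElementaryLadder T
  | plus (J : Bar T) : ElementaryLadder T
  | minus (K : Bar T) : ElementaryLadder T

/-- The morphism `k_J ⟶ k_K`, for `K ≼ J`, that is the identity on `J ∩ K`. -/
noncomputable def PersModule.intervalHom (F : Type u) [Field F] {T : AddSubgroup ℝ} (J K : Bar T)
    (hKJ : K.Overlaps J) : PersModule.Hom (PersModule.interval F J) (PersModule.interval F K) where
  app t := PersModule.toIntervalObj (PersModule.intervalObj F J t) K t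
  naturality := by
    intro s t h x
    apply Subtype.ext
    change (PersModule.toIntervalObj _ K t (PersModule.toIntervalObj (PersModule.intervalObj F J s)
      J t x) : F) = (PersModule.toIntervalObj _ K t (PersModule.toIntervalObj
      (PersModule.intervalObj F J s) K s x) : F)
    by_cases hs : J.Contains s
    · by_cases ht : K.Contains t
      · have h1 : K.Contains s := ⟨hKJ.1.trans hs.1, h.trans ht.2⟩
        have h2 : J.Contains t := ⟨hs.1.trans h, ht.2.trans hKJ.2.2⟩
        simp [PersModule.toIntervalObj, ht, h1, h2]
      · simp [PersModule.toIntervalObj, ht]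
    · simp [PersModule.toIntervalObj, x.2 hs]

/-- The elementary ladder persistence modules. -/
noncomputable def ElementaryLadder.toLadder (F : Type u) [Field F] {T : AddSubgroup ℝ} :
    ElementaryLadder T → Ladder.{u, u, u} F T
  | .R J K h => ⟨PersModule.interval F J, PersModule.interval F K, PersModule.intervalHom F J K h⟩
  | .plus J => ⟨PersModule.interval F J, PersModule.zero F T, ⟨fun _ => 0, fun _ _ => rfl⟩⟩
  | .minus K => ⟨PersModule.zero F T, PersModule.interval F K,
      ⟨fun _ => 0, fun _ _ => (map_zero _).symm⟩⟩

/-- The multiset `D` of elementary ladder persistence modules is a ladder decomposition of `Φ`: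
`(V, W, Φ)` is isomorphic to the direct sum of the members of `D`, with multiplicities. -/
def PersModule.Hom.IsLadderDecomposition {F : Type u} [Field F] {T : AddSubgroup ℝ}
    {V : PersModule.{u, v} F T} {W : PersModule.{u, w} F T} (Φ : PersModule.Hom V W)
    (D : Multiset (ElementaryLadder T)) : Prop :=
  ∃ (n : ℕ) (E : Fin n → ElementaryLadder T), (Finset.univ : Finset (Fin n)).val.map E = D ∧
    Nonempty (Ladder.Iso ⟨V, W, Φ⟩ (Ladder.directSum fun i => (E i).toLadder F))

/-- The pair of bars of `V` and `W` that is matched by an elementary summand of a morphism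
`V ⟶ W(δ)`, if there is one. A bar `[i, j]` of `W(δ)` is the bar `[i + δ, j + δ]` of `W`. -/
def ElementaryLadder.matchedPair {T : AddSubgroup ℝ} (δ : T) :
    ElementaryLadder T → Option (Bar T × Bar T)
  | .R J K _ => some (J, K.translate δ)
  | .plus _ => none
  | .minus _ => none

/-- The matching of the bars of `V` and `W` induced by a ladder decomposition of a morphism
`V ⟶ W(δ)`, as a multiset of pairs. -/
def inducedMatching {T : AddSubgroup ℝ} (δ : T) (D : Multiset (ElementaryLadder T)) :
    Multiset (Bar T × Bar T) :=
  D.filterMap (ElementaryLadder.matchedPair δ)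

/-! Partial matchings and the bottleneck distance. -/

/-- A partial matching of two barcodes, as a multiset of pairs: every bar is used at most as often
as its multiplicity allows. -/
def IsPartialMatching {T : AddSubgroup ℝ} (B C : Multiset (Bar T))
    (χ : Multiset (Bar T × Bar T)) : Prop :=
  χ.map Prod.fst ≤ B ∧ χ.map Prod.snd ≤ C

/-- The cost of matching two bars. -/
noncomputable def pairCost {T : AddSubgroup ℝ} (p : Bar T × Bar T) : ℝ≥0∞ :=
  max (ENNReal.ofReal |(p.1.lo : ℝ) - p.2.lo|) (ENNReal.ofReal |(p.1.hi : ℝ) - p.2.hi|)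

/-- The cost of leaving a bar unmatched: half of its length. -/
noncomputable def unmatchedCost {T : AddSubgroup ℝ} (J : Bar T) : ℝ≥0∞ :=
  ENNReal.ofReal (((J.hi : ℝ) - J.lo) / 2)

open scoped Classical in
/-- The bottleneck cost of a partial matching `χ` of the barcodes `B` and `C`: the maximum of the
costs of the matched pairs and of the unmatched bars. -/
noncomputable def matchingCost {T : AddSubgroup ℝ} (B C : Multiset (Bar T))
    (χ : Multiset (Bar T × Bar T)) : ℝ≥0∞ :=
  max (χ.map pairCost).sup
    (((B - χ.map Prod.fst) + (C - χ.map Prod.snd)).map unmatchedCost).sup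

/-- The bottleneck distance: the smallest cost of a partial matching. -/
noncomputable def bottleneckDist {T : AddSubgroup ℝ} (B C : Multiset (Bar T)) : ℝ≥0∞ :=
  ⨅ (χ : Multiset (Bar T × Bar T)) (_ : IsPartialMatching B C χ), matchingCost B C χ

/-! Existence. Once `V` and `W(δ)` are split into intervals, a morphism between them is a matrix of
scalars: a morphism `k_J ⟶ k_K` is a multiple of the identity on `J ∩ K`, and it can be nonzero only
if `K ≼ J`. A ladder decomposition amounts to bases in which this matrix has at most one nonzero
entry in each row and column. Gaussian elimination is restricted, because a basis change may mix two
bars only in the direction allowed by the componentwise order of their end points. A pivot can clear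
its row and column if its source bar is the least in the row and its target bar the greatest in the
column (`Hom.HasMatrix.exists_clear`). The obstruction is nesting, the only way for two bars to be
incomparable.

The interleaving makes the kernel and the cokernel of `Φ` vanish after a shift by `2δ`, while nested
bars have both ends more than `2δ` apart. Hence if two nested bars occur in one row, lifting the
generator of the target bar along `Φ` yields a third bar of the row below both; columns are treated
similarly (`row_directed`, `col_directed`). Therefore an extremal entry among those not yet isolated
is an admissible pivot, and elimination terminates (`exists_isolated_matrix`).

Cost. In a ladder decomposition `Φ` is diagonal, so the kernel and cokernel conditions can be read
on each summand: the ends of the matched bars of `V` and `W(δ)` differ by an amount in `[0, 2δ]`,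
which becomes `[-δ, δ]` after translation by `δ`, and an unmatched bar is shorter than `2δ`. The
ranks of the inner morphisms determine the barcode, so these bars are those of `V` and `W`.

Optimality. Over a dense index set, a matching whose cost is below some index `η` gives an
`η`-interleaving, so `d_I` is at most the bottleneck distance. If `δ = d_I`, the cost of `χ_Φ` lies
between the bottleneck distance and `δ`, and all are equal. -/

namespace PersModule

/-! ### Coordinates on persistence modules and ranks of inner morphisms. -/

variable {F : Type u} [Field F] {T : AddSubgroup ℝ}

/-- Coordinates on a persistence module, indexed by `ι`, in which the coordinate `i` is supported
on the set `P i` of indices: they identify `V` with a direct sum of copies of `F` living on the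
sets `P i`. -/
structure Coords (V : PersModule.{u, v} F T) {ι : Type*} (P : ι → T → Prop) where
  coord : ∀ t, V.obj t →ₗ[F] (ι → F)
  injective : ∀ t, Function.Injective (coord t)
  support : ∀ t x i, ¬ P i t → coord t x i = 0
  surjective : ∀ t (f : ι → F), (∀ i, ¬ P i t → f i = 0) → ∃ x, coord t x = f
  natural : ∀ {s t : T} (h : s ≤ t) (x : V.obj s) (i : ι), P i t →
    coord t (V.map h x) i = coord s x i

namespace Coords

variable {V : PersModule.{u, v} F T} {ι κ : Type*} {P : ι → T → Prop}

open scoped Classical in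
theorem coord_map (c : Coords V P) {s t : T} (h : s ≤ t) (x : V.obj s) (i : ι) :
    c.coord t (V.map h x) i = if P i t then c.coord s x i else 0 := by
  split_ifs with hi
  · exact c.natural h x i hi
  · exact c.support t _ i hi

theorem ext_iff (c : Coords V P) {t : T} {x y : V.obj t} :
    x = y ↔ ∀ i, c.coord t x i = c.coord t y i :=
  ⟨fun h _ => h ▸ rfl, fun h => c.injective t (funext h)⟩

/-- Coordinates can be reindexed. -/
def reindex (c : Coords V P) (e : κ ≃ ι) : Coords V (fun k => P (e k)) where
  coord t := LinearMap.funLeft F F e ∘ₗ c.coord t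
  injective t := (LinearMap.funLeft_injective_of_surjective F F e e.surjective).comp (c.injective t)
  support t x k hk := c.support t x (e k) hk
  surjective t f hf := by
    obtain ⟨x, hx⟩ := c.surjective t (fun i => f (e.symm i))
      (fun i hi => hf _ (by simpa using hi))
    refine ⟨x, ?_⟩
    ext k
    simp [hx, LinearMap.funLeft_apply]
  natural h x k hk := c.natural h x (e k) hk

/-- Coordinates of a shifted module. -/
def shift (c : Coords V P) (δ : T) : Coords (V.shift δ) (fun i t => P i (t + δ)) where
  coord t := c.coord (t + δ)
  injective t := c.injective (t + δ)
  support t := c.support (t + δ)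
  surjective t := c.surjective (t + δ)
  natural h x i hi := c.natural (add_le_add_left h δ) x i hi

/-- Coordinates with other, equivalent, supports. -/
def congr (c : Coords V P) {Q : ι → T → Prop} (h : ∀ i t, P i t ↔ Q i t) : Coords V Q where
  coord := c.coord
  injective := c.injective
  support t x i hi := c.support t x i ((h i t).not.2 hi)
  surjective t f hf := c.surjective t f fun i hi => hf i ((h i t).not.1 hi)
  natural hst x i hi := c.natural hst x i ((h i _).2 hi)

/-- A linear inverse of the coordinate map. -/
theorem exists_inverse (c : Coords V P) (t : T) : ∃ g : (ι → F) →ₗ[F] V.obj t,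
    ∀ f : ι → F, (∀ i, ¬ P i t → f i = 0) → c.coord t (g f) = f := by
  obtain ⟨g, hg⟩ := LinearMap.exists_leftInverse_of_injective (c.coord t)
    (LinearMap.ker_eq_bot.2 (c.injective t))
  refine ⟨g, fun f hf => ?_⟩
  obtain ⟨x, rfl⟩ := c.surjective t f hf
  have : g (c.coord t x) = x := LinearMap.congr_fun hg x
  rw [this]

theorem exists_hom {W : PersModule.{u, w} F T} {Q : κ → T → Prop} (c : Coords V P)
    (d : Coords W Q) (m : T → (ι → F) →ₗ[F] (κ → F))
    (hm : ∀ t x k, ¬ Q k t → m t (c.coord t x) k = 0)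
    (hnat : ∀ {s t : T} (h : s ≤ t) (x : V.obj s) k, Q k t →
      m t (c.coord t (V.map h x)) k = m s (c.coord s x) k) :
    ∃ Φ : Hom V W, ∀ t x, d.coord t (Φ.app t x) = m t (c.coord t x) := by
  choose g hg using d.exists_inverse
  have key : ∀ t x, d.coord t ((g t ∘ₗ m t ∘ₗ c.coord t) x) = m t (c.coord t x) :=
    fun t x => hg t _ (hm t x)
  refine ⟨⟨fun t => g t ∘ₗ m t ∘ₗ c.coord t, fun {s t} h x => ?_⟩, key⟩
  rw [d.ext_iff]
  intro k
  by_cases hk : Q k t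
  · rw [d.natural h _ k hk, key, key, hnat h x k hk]
  · rw [d.support t _ k hk, d.support t _ k hk]

open scoped Classical in
/-- The rank of an inner morphism is the number of coordinates that persist. -/
theorem finrank_range_map [Fintype ι] (c : Coords V P) {s t : T} (h : s ≤ t) :
    Module.finrank F (LinearMap.range (V.map h)) =
      (Finset.univ.filter fun i => P i s ∧ P i t).card := by
  -- In coordinates the image consists of the functions supported on the indices alive at both `s`
  -- and `t`.
  set S : Set ι := {i | P i s ∧ P i t}
  have h1 : Module.finrank F (LinearMap.range (V.map h)) =
      Module.finrank F (LinearMap.range (c.coord t ∘ₗ V.map h)) := by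
    rw [LinearMap.range_comp]
    exact (LinearEquiv.finrank_eq (Submodule.equivMapOfInjective _ (c.injective t) _))
  have hinj : Function.Injective (Function.ExtendByZero.linearMap F ((↑) : S → ι)) := by
    intro f g hfg
    ext i
    have : Function.extend ((↑) : S → ι) f 0 i = Function.extend ((↑) : S → ι) g 0 i :=
      congrFun hfg i
    rwa [Subtype.val_injective.extend_apply, Subtype.val_injective.extend_apply] at this
  have h2 : LinearMap.range (c.coord t ∘ₗ V.map h) =
      LinearMap.range (Function.ExtendByZero.linearMap F ((↑) : S → ι)) := by
    ext f
    simp only [LinearMap.mem_range, LinearMap.comp_apply]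
    constructor
    · rintro ⟨x, rfl⟩
      refine ⟨fun i => c.coord t (V.map h x) i, ?_⟩
      ext i
      change Function.extend ((↑) : S → ι) (fun j : S => c.coord t (V.map h x) j) 0 i = _
      by_cases hi : i ∈ S
      · exact Subtype.val_injective.extend_apply _ _ (⟨i, hi⟩ : S)
      · have h0 : c.coord t (V.map h x) i = 0 := by
          rw [c.coord_map]
          split_ifs with ht
          · exact c.support _ _ _ fun hs => hi ⟨hs, ht⟩
          · rfl
        rw [h0]
        exact Function.extend_apply' _ _ _ (by rintro ⟨⟨j, hj⟩, rfl⟩; exact hi hj)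
    · rintro ⟨f, rfl⟩
      set g := Function.ExtendByZero.linearMap F ((↑) : S → ι) f
      have hg : ∀ i ∉ S, g i = 0 := fun i hi =>
        Function.extend_apply' f (0 : ι → F) i (by rintro ⟨⟨j, hj⟩, rfl⟩; exact hi hj)
      obtain ⟨x, hx⟩ := c.surjective s g fun i hi => hg i fun hS => hi hS.1
      refine ⟨x, ?_⟩
      ext i
      rw [c.coord_map, hx]
      split_ifs with ht
      · rfl
      · exact (hg i fun hS => ht hS.2).symm
  rw [h1, h2, LinearMap.finrank_range_of_inj hinj, Module.finrank_fintype_fun_eq_card,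
    Fintype.card_subtype]
  rfl

end Coords

/-! Ranks determine the barcode. -/

/-- The bar `J` persists from `s` to `t`. -/
def _root_.Bar.Spans (s t : T) (J : Bar T) : Prop := J.lo ≤ s ∧ t ≤ J.hi

theorem _root_.Bar.spans_iff {s t : T} (h : s ≤ t) (J : Bar T) :
    J.Spans s t ↔ J.Contains s ∧ J.Contains t :=
  ⟨fun hJ => ⟨⟨hJ.1, h.trans hJ.2⟩, hJ.1.trans h, hJ.2⟩, fun hJ => ⟨hJ.1.1, hJ.2.2⟩⟩

open scoped Classical in
/-- The ranks of the inner morphisms of `V` are those of a module with barcode `B`. -/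
def HasRanks (V : PersModule.{u, v} F T) (B : Multiset (Bar T)) : Prop :=
  ∀ (s t : T) (h : s ≤ t),
    Module.finrank F (LinearMap.range (V.map h)) = B.countP (Bar.Spans s t)

-- Let `J` be a bar that is maximal for inclusion in `B + C`. The only bars spanning from `J.lo` to
-- `J.hi` are then copies of `J`, so the counts show that `J` occurs in both multisets. It is
-- removed from both, and the rest follows by induction.
open scoped Classical in
theorem _root_.Multiset.eq_of_countP_spans_eq (B C : Multiset (Bar T))
    (h : ∀ s t : T, s ≤ t → B.countP (Bar.Spans s t) = C.countP (Bar.Spans s t)) : B = C := by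
  induction hn : B.card generalizing B C with
  | zero =>
    have hB : B = 0 := Multiset.card_eq_zero.1 hn
    subst hB
    symm
    refine Multiset.eq_zero_of_forall_notMem fun J hJ => ?_
    have := h J.lo J.hi J.lo_le_hi
    rw [Multiset.countP_zero, eq_comm, Multiset.countP_eq_zero] at this
    exact this J hJ ⟨le_rfl, le_rfl⟩
  | succ n ih =>
    -- With the lower end reversed, the product order is inclusion of bars.
    let f : Bar T → Tᵒᵈ × T := fun J => (OrderDual.toDual J.lo, J.hi)
    have hne : ((B + C).toFinset.image f).Nonempty := by
      have : B ≠ 0 := by rintro rfl; simp at hn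
      obtain ⟨J, hJ⟩ := Multiset.exists_mem_of_ne_zero this
      exact ⟨f J, Finset.mem_image_of_mem _ (by simp [hJ])⟩
    obtain ⟨_, hm⟩ := Finset.exists_maximal hne
    obtain ⟨J, hJ, rfl⟩ := Finset.mem_image.1 hm.1
    have hmax : ∀ I ∈ B + C, I.Spans J.lo J.hi → I = J := by
      intro I hI hIJ
      have h1 : f J ≤ f I := ⟨hIJ.1, hIJ.2⟩
      have h2 := hm.2 (Finset.mem_image_of_mem f (Multiset.mem_toFinset.2 hI)) h1
      exact Bar.ext (le_antisymm hIJ.1 h2.1) (le_antisymm h2.2 hIJ.2)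
    have hiff : J ∈ B ↔ J ∈ C := by
      have hp := h J.lo J.hi J.lo_le_hi
      have hJJ : J.Spans J.lo J.hi := ⟨le_rfl, le_rfl⟩
      constructor
      · intro hB
        have : 0 < C.countP (Bar.Spans J.lo J.hi) := hp ▸ Multiset.countP_pos.2 ⟨J, hB, hJJ⟩
        obtain ⟨I, hI, hIJ⟩ := Multiset.countP_pos.1 this
        exact hmax I (by simp [hI]) hIJ ▸ hI
      · intro hC
        have : 0 < B.countP (Bar.Spans J.lo J.hi) := hp ▸ Multiset.countP_pos.2 ⟨J, hC, hJJ⟩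
        obtain ⟨I, hI, hIJ⟩ := Multiset.countP_pos.1 this
        exact hmax I (by simp [hI]) hIJ ▸ hI
    have hB : J ∈ B := by
      rcases Multiset.mem_add.1 (Multiset.mem_toFinset.1 hJ) with h | h
      exacts [h, hiff.2 h]
    obtain ⟨B', rfl⟩ := Multiset.exists_cons_of_mem hB
    obtain ⟨C', rfl⟩ := Multiset.exists_cons_of_mem (hiff.1 hB)
    rw [ih B' C' (fun s t hst => ?_) (by simpa using hn)]
    simpa [Multiset.countP_cons] using h s t hst

/-- `barcode` is defined by a choice; this identifies it with the multiset of bars read off from any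
other decomposition. -/
theorem HasRanks.unique {V : PersModule.{u, v} F T} {B C : Multiset (Bar T)}
    (hB : V.HasRanks B) (hC : V.HasRanks C) : B = C :=
  Multiset.eq_of_countP_spans_eq B C fun s t h => (hB s t h).symm.trans (hC s t h)

open scoped Classical in
theorem _root_.Multiset.countP_filterMap_eq {α β : Type*} (f : α → Option β) (p : β → Prop)
    (m : Multiset α) :
    (m.filterMap f).countP p = m.countP fun a => ∃ b ∈ f a, p b := by
  induction m using Multiset.induction with
  | empty => simp
  | cons a m ih =>
    cases h : f a with
    | none => simp [Multiset.filterMap_cons_none a m h, h, ih]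
    | some b => simp [Multiset.filterMap_cons_some f a m h, h, ih, Multiset.countP_cons]

/-- The set of indices of an optional bar. -/
def _root_.Bar.OptContains (o : Option (Bar T)) (t : T) : Prop := ∃ J ∈ o, J.Contains t

theorem Coords.hasRanks {V : PersModule.{u, v} F T} {ι : Type*} [Fintype ι]
    {o : ι → Option (Bar T)} (c : Coords V fun i => Bar.OptContains (o i)) :
    V.HasRanks ((Finset.univ : Finset ι).val.filterMap o) := by
  classical
  intro s t h
  rw [c.finrank_range_map h, Multiset.countP_filterMap_eq, Multiset.countP_eq_card_filter]
  refine congrArg Finset.card (Finset.filter_congr fun i _ => ?_)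
  cases hi : o i with
  | none => simp [Bar.OptContains]
  | some J => simp [Bar.OptContains, Bar.spans_iff h]

theorem Coords.hasRanks_bars {V : PersModule.{u, v} F T} {ι : Type*} [Fintype ι]
    {J : ι → Bar T} (c : Coords V fun i => (J i).Contains) :
    V.HasRanks ((Finset.univ : Finset ι).val.map J) := by
  rw [← Multiset.filterMap_eq_map]
  exact (c.congr (Q := fun i => Bar.OptContains (some (J i)))
    (by simp [Bar.OptContains])).hasRanks

theorem HasRanks.shift {V : PersModule.{u, v} F T} {B : Multiset (Bar T)} (h : V.HasRanks B)
    (δ : T) : (V.shift δ).HasRanks (B.map fun J => J.translate (-δ)) := by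
  classical
  intro s t hst
  rw [Multiset.countP_map, ← Multiset.countP_eq_card_filter]
  refine (h (s + δ) (t + δ) (add_le_add_left hst δ)).trans ?_
  refine Multiset.countP_congr rfl fun J _ => ?_
  simp [Bar.Spans, Bar.translate, ← sub_eq_add_neg, le_sub_iff_add_le]

end PersModule

namespace PersModule

variable {F : Type u} [Field F] {T : AddSubgroup ℝ}

/-! The structure theorem for finitely indexed modules. -/

/-- The finite set `S` contains all indices at which `V` changes. -/
structure IsIndexedBy (V : PersModule.{u, v} F T) (S : Finset T) : Prop where
  finite : ∀ t, Module.Finite F (V.obj t)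
  bounds : ∀ t, Nontrivial (V.obj t) → (∃ a ∈ S, a ≤ t) ∧ (∃ b ∈ S, t ≤ b)
  surjective : ∀ (s t : T) (h : s ≤ t), (∀ c ∈ S, ¬ (s < c ∧ c ≤ t)) →
    Function.Surjective (V.map h)
  injective : ∀ (s t : T) (h : s ≤ t), (∀ c ∈ S, ¬ (s ≤ c ∧ c < t)) →
    Function.Injective (V.map h)

/-- A submodule of a persistence module. -/
def sub (V : PersModule.{u, v} F T) (N : ∀ t, Submodule F (V.obj t))
    (hN : ∀ {s t : T} (h : s ≤ t), ∀ x ∈ N s, V.map h x ∈ N t) : PersModule.{u, v} F T where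
  obj t := N t
  map h := (V.map h).restrict (hN h)
  map_refl t x := Subtype.ext (V.map_refl t x)
  map_map h k x := Subtype.ext (V.map_map h k x)

/-- No class is born strictly after the last index of `S` below `t`, so whatever lives at `t` comes
from there. -/
theorem IsIndexedBy.exists_nontrivial_le {V : PersModule.{u, v} F T} {S : Finset T}
    (hV : V.IsIndexedBy S) {t : T} (ht : Nontrivial (V.obj t)) :
    ∃ a ∈ S, a ≤ t ∧ Nontrivial (V.obj a) := by
  obtain ⟨a, ha⟩ := Finset.exists_maximal (s := S.filter (· ≤ t)) (by
    obtain ⟨a, ha, hat⟩ := (hV.bounds t ht).1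
    exact ⟨a, Finset.mem_filter.2 ⟨ha, hat⟩⟩)
  obtain ⟨haS, hat⟩ := Finset.mem_filter.1 ha.1
  refine ⟨a, haS, hat, ?_⟩
  refine (hV.surjective a t hat fun c hc hac => ?_).nontrivial
  exact absurd (ha.2 (Finset.mem_filter.2 ⟨hc, hac.2⟩) hac.1.le) (not_le.2 hac.1)

/-- No class dies on the way from `t` to the next index of `S`. -/
theorem IsIndexedBy.exists_ne_zero_ge {V : PersModule.{u, v} F T} {S : Finset T}
    (hV : V.IsIndexedBy S) {t : T} {x : V.obj t} (hx : x ≠ 0) :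
    ∃ b ∈ S, ∃ h : t ≤ b, V.map h x ≠ 0 := by
  obtain ⟨b, hb⟩ := Finset.exists_minimal (s := S.filter (t ≤ ·)) (by
    obtain ⟨b, hb, htb⟩ := (hV.bounds t ⟨x, 0, hx⟩).2
    exact ⟨b, Finset.mem_filter.2 ⟨hb, htb⟩⟩)
  obtain ⟨hbS, htb⟩ := Finset.mem_filter.1 hb.1
  refine ⟨b, hbS, htb, ?_⟩
  refine (map_ne_zero_iff _ (hV.injective t b htb fun c hc htc => ?_)).2 hx
  exact absurd (hb.2 (Finset.mem_filter.2 ⟨hc, htc.1⟩) htc.2.le) (not_le.2 htc.2)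

/-- If a morphism `f` to an interval module has a section, given by the elements `x t`, then the
interval splits off: coordinates on the kernel of `f` extend to coordinates on `V`. -/
theorem exists_coords_option {V : PersModule.{u, v} F T} (J : Bar T)
    (f : ∀ t, V.obj t →ₗ[F] F) (x : ∀ t, V.obj t)
    (hf : ∀ {s t : T} (h : s ≤ t) (y : V.obj s), t ≤ J.hi → f t (V.map h y) = f s y)
    (hf0 : ∀ t y, ¬ J.Contains t → f t y = 0)
    (hx : ∀ {s t : T} (h : s ≤ t), J.lo ≤ s → V.map h (x s) = x t)
    (hx0 : ∀ t, ¬ J.Contains t → x t = 0)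
    (hfx : ∀ t, J.Contains t → f t (x t) = 1) :
    ∃ hN : (∀ {s t : T} (h : s ≤ t), ∀ y ∈ LinearMap.ker (f s), V.map h y ∈ LinearMap.ker (f t)),
      (∀ S, V.IsIndexedBy S → (V.sub (fun t => LinearMap.ker (f t)) hN).IsIndexedBy S) ∧
      ∀ {ι : Type} {I : ι → Bar T},
        Coords (V.sub (fun t => LinearMap.ker (f t)) hN) (fun i => (I i).Contains) →
        Nonempty (Coords V fun o : Option ι => (o.elim J I).Contains) := by
  have hN : ∀ {s t : T} (h : s ≤ t), ∀ y ∈ LinearMap.ker (f s), V.map h y ∈ LinearMap.ker (f t) := by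
    intro s t h y hy
    by_cases ht : t ≤ J.hi
    · rw [LinearMap.mem_ker, hf h y ht, hy]
    · exact hf0 t _ fun hJ => ht hJ.2
  refine ⟨hN, ?_, ?_⟩
  all_goals
    -- The projection to the kernel along the section commutes with the inner morphisms, so it
    -- splits `V` as the interval plus the kernel.
    let p : ∀ t, V.obj t →ₗ[F] LinearMap.ker (f t) := fun t =>
      (LinearMap.id - (LinearMap.toSpanSingleton F _ (x t)) ∘ₗ f t).codRestrict _ (by
        intro y
        by_cases ht : J.Contains t
        · simp [hfx t ht]
        · exact hf0 t _ ht)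
    have hp : ∀ t y, (p t y : V.obj t) = y - f t y • x t := fun t y => rfl
    have hpn : ∀ {s t : T} (h : s ≤ t) (y : V.obj s),
        (p t (V.map h y) : V.obj t) = V.map h (p s y) := by
      intro s t h y
      rw [hp, hp, map_sub, map_smul]
      congr 1
      by_cases ht : t ≤ J.hi
      · rw [hf h y ht]
        by_cases hs : J.lo ≤ s
        · rw [hx h hs]
        · rw [hf0 s y fun hJ => hs hJ.1, zero_smul, zero_smul]
      · rw [hx0 t fun hJ => ht hJ.2, smul_zero]
        by_cases hs : J.lo ≤ s
        · rw [hx h hs, hx0 t fun hJ => ht hJ.2, smul_zero]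
        · rw [hf0 s y fun hJ => hs hJ.1, zero_smul]
    have hpk : ∀ t (y : LinearMap.ker (f t)), p t y = y := by
      intro t y
      apply Subtype.ext
      rw [hp, LinearMap.mem_ker.1 y.2, zero_smul, sub_zero]
  · intro S hV
    refine ⟨fun t => ?_, fun t ht => ?_, fun s t h hS y => ?_, fun s t h hS y z hyz => ?_⟩
    · have := hV.finite t
      exact inferInstanceAs (Module.Finite F (LinearMap.ker (f t)))
    · have ht' : Nontrivial (LinearMap.ker (f t)) := ht
      exact hV.bounds t (Subtype.val_injective (p := fun z => z ∈ LinearMap.ker (f t))).nontrivial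
    · obtain ⟨z, hz⟩ := hV.surjective s t h hS y.1
      refine ⟨p s z, Subtype.ext ((hpn h z).symm.trans ?_)⟩
      rw [hz]
      exact congrArg Subtype.val (hpk t y)
    · exact Subtype.ext (hV.injective s t h hS (congrArg Subtype.val hyz))
  · intro ι I c
    refine ⟨⟨fun t => LinearMap.pi fun o => o.elim (f t) fun i =>
      LinearMap.proj i ∘ₗ c.coord t ∘ₗ p t, ?_, ?_, ?_, ?_⟩⟩
    · intro t y z hyz
      have h1 : f t y = f t z := congrFun hyz none
      have h2 : p t y = p t z := c.injective t (funext fun i => congrFun hyz (some i))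
      have h3 := congrArg Subtype.val h2
      rw [hp, hp, h1] at h3
      exact sub_left_injective h3
    · rintro t y (_ | i) hi
      · exact hf0 t y hi
      · exact c.support t _ i hi
    · intro t g hg
      obtain ⟨y, hy⟩ := c.surjective t (fun i => g (some i)) fun i hi => hg (some i) hi
      have hpx : p t (x t) = 0 := by
        apply Subtype.ext
        rw [hp]
        by_cases ht : J.Contains t
        · simp [hfx t ht]
        · rw [hx0 t ht]; simp
      refine ⟨y.1 + g none • x t, ?_⟩
      ext o
      cases o with
      | none =>
        change f t (y.1 + g none • x t) = _
        rw [map_add, LinearMap.mem_ker.1 y.2, map_smul, zero_add]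
        by_cases ht : J.Contains t
        · simp [hfx t ht]
        · rw [hf0 t _ ht, hg none ht, smul_zero]
      | some i =>
        have hpy : p t (y.1 + g none • x t) = y := by
          rw [map_add, map_smul, hpx, smul_zero, add_zero]
          exact hpk t y
        exact (congrArg (fun z => c.coord t z i) hpy).trans (congrFun hy i)
    · rintro s t h y (_ | i) hi
      · exact hf h y hi.2
      · change c.coord t (p t (V.map h y)) i = c.coord s (p s y) i
        rw [← c.natural h (p s y) i hi]
        exact congrArg (fun z => c.coord t z i) (Subtype.ext (hpn h y))

/-- A class `x` born at the first index `a` where `V` is nonzero, and living until `b`, spans an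
interval `[a, b]`. A functional on `V_b` that equals 1 on the image of `x`, pulled back to all
earlier indices, is a retraction onto it. Splitting it off lowers the dimension at `a`, and the
total dimension over `S` drives the induction. -/
theorem IsIndexedBy.exists_coords {V : PersModule.{u, v} F T} {S : Finset T}
    (hV : V.IsIndexedBy S) :
    ∃ (ι : Type) (_ : Fintype ι) (J : ι → Bar T), Nonempty (Coords V fun i => (J i).Contains) := by
  induction hn : ∑ s ∈ S, Module.finrank F (V.obj s) using Nat.strong_induction_on
    generalizing V with
  | _ n ih =>
  by_cases htriv : ∀ t, Subsingleton (V.obj t)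
  · refine ⟨Empty, inferInstance, Empty.elim, ⟨⟨fun t => 0, fun t => ?_, ?_, ?_, ?_⟩⟩⟩
    · exact Function.injective_of_subsingleton _
    · exact fun t x i => i.elim
    · exact fun t f _ => ⟨0, Subsingleton.elim _ _⟩
    · exact fun _ _ i => i.elim
  · push Not at htriv
    classical
    obtain ⟨t₀, ht₀⟩ := htriv
    obtain ⟨a₀, ha₀, -, ha₀'⟩ := hV.exists_nontrivial_le ht₀
    obtain ⟨a, ha⟩ := Finset.exists_minimal (s := S.filter fun s => Nontrivial (V.obj s))
      ⟨a₀, Finset.mem_filter.2 ⟨ha₀, ha₀'⟩⟩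
    obtain ⟨haS, hVa⟩ := Finset.mem_filter.1 ha.1
    have hbelow : ∀ t, t < a → Subsingleton (V.obj t) := by
      intro t hta
      by_contra hcon
      obtain ⟨c, hcS, hct, hc⟩ := hV.exists_nontrivial_le (not_subsingleton_iff_nontrivial.1 hcon)
      exact absurd (ha.2 (Finset.mem_filter.2 ⟨hcS, hc⟩) (hct.trans hta.le))
        (not_le.2 (hct.trans_lt hta))
    obtain ⟨x, hx⟩ := exists_ne (0 : V.obj a)
    obtain ⟨b, hb⟩ := Finset.exists_maximal (s := S.filter fun s => ∃ h : a ≤ s, V.map h x ≠ 0)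
      ⟨a, Finset.mem_filter.2 ⟨haS, le_rfl, by rwa [V.map_refl]⟩⟩
    obtain ⟨hbS, hab, hxb⟩ := Finset.mem_filter.1 hb.1
    obtain ⟨g, hg⟩ := Module.Projective.exists_dual_eq_one F hxb
    let J : Bar T := ⟨a, b, hab⟩
    let f : ∀ t, V.obj t →ₗ[F] F := fun t => if h : t ≤ b then g ∘ₗ V.map h else 0
    let y : ∀ t, V.obj t := fun t => if h : a ≤ t then V.map h x else 0
    have hfx : ∀ t, J.Contains t → f t (y t) = 1 := by
      intro t ht
      have h1 : f t = g ∘ₗ V.map ht.2 := dif_pos ht.2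
      have h2 : y t = V.map ht.1 x := dif_pos ht.1
      rw [h1, h2, LinearMap.comp_apply, V.map_map, hg]
    have hsplit := exists_coords_option (V := V) J f y ?_ ?_ ?_ ?_ hfx
    · obtain ⟨hN, hN1, hN2⟩ := hsplit
      obtain ⟨ι, hι, I, ⟨c⟩⟩ := ih (∑ s ∈ S, Module.finrank F (LinearMap.ker (f s))) (by
        rw [← hn]
        have := hV.finite
        refine Finset.sum_lt_sum (fun s _ => Submodule.finrank_le _) ⟨a, haS, ?_⟩
        refine Submodule.finrank_lt fun htop => ?_
        have h1 := hfx a ⟨le_rfl, hab⟩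
        rw [LinearMap.ker_eq_top.1 htop] at h1
        exact zero_ne_one h1) (hN1 S hV) rfl
      obtain ⟨c'⟩ := hN2 c
      exact ⟨Option ι, inferInstance, _, ⟨c'⟩⟩
    · intro s t h z ht
      have h1 : f t = g ∘ₗ V.map ht := dif_pos ht
      have h2 : f s = g ∘ₗ V.map (h.trans ht) := dif_pos _
      rw [h1, h2, LinearMap.comp_apply, V.map_map, LinearMap.comp_apply]
    · intro t z ht
      by_cases htb : t ≤ b
      · have := hbelow t (not_le.1 fun hat => ht ⟨hat, htb⟩)
        rw [Subsingleton.elim z 0, map_zero]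
      · have h1 : f t = 0 := dif_neg htb
        rw [h1, LinearMap.zero_apply]
    · intro s t h hs
      have h1 : y s = V.map hs x := dif_pos hs
      have h2 : y t = V.map (hs.trans h) x := dif_pos _
      rw [h1, h2, V.map_map]
    · intro t ht
      by_cases hat : a ≤ t
      swap
      · exact dif_neg hat
      have htb : b < t := not_le.1 fun htb => ht ⟨hat, htb⟩
      have h2 : y t = V.map hat x := dif_pos _
      -- If the class of `x` were alive at some `t > b`, it would also be alive at an index of `S`
      -- beyond `b`, against the choice of `b`.
      by_contra hne
      obtain ⟨c, hcS, htc, hc⟩ := hV.exists_ne_zero_ge hne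
      rw [h2, V.map_map] at hc
      exact absurd (hb.2 (Finset.mem_filter.2 ⟨hcS, _, hc⟩) (htb.le.trans htc))
        (not_le.2 (htb.trans_le htc))

end PersModule

namespace PersModule

variable {F : Type u} [Field F] {T : AddSubgroup ℝ}

/-! Coordinates and isomorphisms with direct sums. -/

/-- A coordinate on a module that is a copy of `F` on the set `P` of indices, and zero elsewhere. -/
structure Coord (M : PersModule.{u, v} F T) (P : T → Prop) where
  val : ∀ t, M.obj t →ₗ[F] F
  inv : ∀ t, F →ₗ[F] M.obj t
  left_inv : ∀ t x, inv t (val t x) = x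
  right_inv : ∀ t a, P t → val t (inv t a) = a
  support : ∀ t x, ¬ P t → val t x = 0
  natural : ∀ {s t : T} (h : s ≤ t) (x : M.obj s), P t → val t (M.map h x) = val s x

theorem toIntervalObj_coe {A : Submodule F F} {K : Bar T} {t : T} (h : K.Contains t) (x : A) :
    (toIntervalObj A K t x : F) = x := if_pos h

variable (F) in
/-- The coordinate of an interval module. -/
noncomputable def intervalCoord (J : Bar T) : Coord (interval F J) (Bar.OptContains (some J)) where
  val t := (intervalObj F J t).subtype
  inv t := toIntervalObj ⊤ J t ∘ₗ LinearMap.id.codRestrict ⊤ (fun _ => trivial)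
  left_inv t x := by
    apply Subtype.ext
    by_cases h : J.Contains t
    · exact toIntervalObj_coe h _
    · exact (if_neg h).trans (x.2 h).symm
  right_inv t a h := by
    obtain ⟨_, hI, h⟩ := h
    cases hI
    exact toIntervalObj_coe h _
  support t x h := x.2 fun h' => h ⟨J, rfl, h'⟩
  natural := by
    rintro s t h x ⟨_, hI, ht⟩
    cases hI
    exact toIntervalObj_coe ht x

variable (F) in
/-- The coordinate of the zero module. -/
def zeroCoord : Coord (zero F T) (Bar.OptContains none) where
  val _ := 0
  inv _ := 0
  left_inv _ _ := rfl
  right_inv _ _ h := by simp [Bar.OptContains] at h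
  support _ _ _ := rfl
  natural _ _ _ := rfl

namespace Coords

variable {n : ℕ} {M : Fin n → PersModule.{u, w} F T} {P : Fin n → T → Prop}
  {V : PersModule.{u, v} F T}

/-- Coordinates from an isomorphism with a direct sum. -/
def ofIso (e : Iso V (PersModule.directSum M)) (m : ∀ i, Coord (M i) (P i)) : Coords V P where
  coord t := LinearMap.pi fun i => (m i).val t ∘ₗ LinearMap.proj i ∘ₗ (e.equiv t).toLinearMap
  injective t x y h := by
    apply (e.equiv t).injective
    funext i
    rw [← (m i).left_inv t (e.equiv t x i), ← (m i).left_inv t (e.equiv t y i)]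
    exact congrArg _ (congrFun h i)
  support t x i h := (m i).support t _ h
  surjective t f hf := by
    obtain ⟨x, hx⟩ := (e.equiv t).surjective fun i => (m i).inv t (f i)
    refine ⟨x, ?_⟩
    ext i
    refine (congrArg ((m i).val t) (congrFun hx i)).trans ?_
    by_cases h : P i t
    · exact (m i).right_inv t _ h
    · rw [hf i h, (m i).support t _ h]
  natural h x i hi := by
    refine Eq.trans ?_ ((m i).natural h _ hi)
    exact congrArg _ (congrFun (e.naturality h x) i)

/-- An isomorphism with a direct sum from coordinates. -/
noncomputable def toIso (c : Coords V P) (m : ∀ i, Coord (M i) (P i)) :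
    Iso V (PersModule.directSum M) where
  equiv t := LinearEquiv.ofBijective
    (LinearMap.pi fun i => (m i).inv t ∘ₗ LinearMap.proj i ∘ₗ c.coord t :
      V.obj t →ₗ[F] ∀ i, (M i).obj t) (by
    constructor
    · intro x y h
      rw [c.ext_iff]
      intro i
      by_cases hi : P i t
      · rw [← (m i).right_inv t (c.coord t x i) hi, ← (m i).right_inv t (c.coord t y i) hi]
        exact congrArg _ (congrFun h i)
      · rw [c.support t x i hi, c.support t y i hi]
    · intro y
      obtain ⟨x, hx⟩ := c.surjective t (fun i => (m i).val t (y i))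
        fun i hi => (m i).support t _ hi
      refine ⟨x, ?_⟩
      funext i
      change (m i).inv t (c.coord t x i) = y i
      rw [hx, (m i).left_inv])
  naturality {s t} h x := by
    funext i
    change (m i).inv t (c.coord t (V.map h x) i) = (M i).map h ((m i).inv s (c.coord s x i))
    rw [← (m i).left_inv t ((M i).map h ((m i).inv s (c.coord s x i)))]
    congr 1
    by_cases hi : P i t
    · rw [c.natural h x i hi, (m i).natural h _ hi]
      by_cases hs : P i s
      · rw [(m i).right_inv s _ hs]
      · rw [c.support s x i hs, (m i).support s _ hs]
    · rw [c.support t _ i hi, (m i).support t _ hi]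

end Coords

theorem _root_.Bar.optContains_some (J : Bar T) (t : T) :
    Bar.OptContains (some J) t ↔ J.Contains t := by simp [Bar.OptContains]

theorem isBarcode_iff {V : PersModule.{u, v} F T} {B : Multiset (Bar T)} :
    IsBarcode V B ↔ ∃ (n : ℕ) (J : Fin n → Bar T), (Finset.univ : Finset (Fin n)).val.map J = B ∧
      Nonempty (Coords V fun i => (J i).Contains) := by
  constructor
  · rintro ⟨n, J, hJ, ⟨e⟩⟩
    exact ⟨n, J, hJ, ⟨(Coords.ofIso e fun i => intervalCoord F (J i)).congr
      fun i t => Bar.optContains_some (J i) t⟩⟩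
  · rintro ⟨n, J, hJ, ⟨c⟩⟩
    exact ⟨n, J, hJ, ⟨(c.congr fun i t => (Bar.optContains_some (J i) t).symm).toIso
      fun i => intervalCoord F (J i)⟩⟩

theorem IsFinitelyIndexed.isBarcode_barcode {V : PersModule.{u, v} F T}
    (hV : V.IsFinitelyIndexed) : IsBarcode V V.barcode := by
  have h : ∃ B, IsBarcode V B := by
    obtain ⟨h1, S, h2, h3, h4⟩ := hV
    obtain ⟨ι, hι, J, ⟨c⟩⟩ := IsIndexedBy.exists_coords ⟨h1, h2, h3, h4⟩
    let e := (Fintype.equivFin ι).symm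
    exact ⟨_, isBarcode_iff.2 ⟨Fintype.card ι, fun k => J (e k), rfl, ⟨c.reindex e⟩⟩⟩
  have h' : V.barcode = h.choose := dif_pos h
  rw [h']
  exact h.choose_spec

theorem IsFinitelyIndexed.hasRanks {V : PersModule.{u, v} F T} (hV : V.IsFinitelyIndexed) :
    V.HasRanks V.barcode := by
  obtain ⟨n, J, hJ, ⟨c⟩⟩ := isBarcode_iff.1 hV.isBarcode_barcode
  exact hJ ▸ c.hasRanks_bars

end PersModule

/-! ### Ladder decompositions as diagonal morphisms in coordinates. -/

open PersModule

variable {F : Type u} [Field F] {T : AddSubgroup ℝ}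

/-- The bar on the source side of an elementary ladder module. -/
def ElementaryLadder.srcBar : ElementaryLadder T → Option (Bar T)
  | .R J _ _ => some J
  | .plus J => some J
  | .minus _ => none

/-- The bar on the target side of an elementary ladder module. -/
def ElementaryLadder.tgtBar : ElementaryLadder T → Option (Bar T)
  | .R _ K _ => some K
  | .plus _ => none
  | .minus K => some K

variable (F) in
/-- The coordinate of the source of an elementary ladder module. -/
noncomputable def ElementaryLadder.srcCoord : ∀ E : ElementaryLadder T,
    Coord (E.toLadder F).src (Bar.OptContains E.srcBar)
  | .R J _ _ => intervalCoord F J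
  | .plus J => intervalCoord F J
  | .minus _ => zeroCoord F

variable (F) in
/-- The coordinate of the target of an elementary ladder module. -/
noncomputable def ElementaryLadder.tgtCoord : ∀ E : ElementaryLadder T,
    Coord (E.toLadder F).tgt (Bar.OptContains E.tgtBar)
  | .R _ K _ => intervalCoord F K
  | .plus _ => zeroCoord F
  | .minus K => intervalCoord F K

theorem ElementaryLadder.tgtCoord_hom (E : ElementaryLadder T) (t : T)
    (x : (E.toLadder F).src.obj t) (ht : Bar.OptContains E.tgtBar t) :
    (E.tgtCoord F).val t ((E.toLadder F).hom.app t x) = (E.srcCoord F).val t x := by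
  cases E with
  | R J K h =>
    obtain ⟨I, hI, ht⟩ := ht
    cases hI
    exact toIntervalObj_coe ht x
  | plus J => obtain ⟨_, h, -⟩ := ht; cases h
  | minus K => rfl

/-- Ladder decompositions in coordinates. -/
theorem PersModule.Hom.isLadderDecomposition_iff {V : PersModule.{u, v} F T}
    {U : PersModule.{u, w} F T} {Φ : Hom V U} {D : Multiset (ElementaryLadder T)} :
    Φ.IsLadderDecomposition D ↔ ∃ (n : ℕ) (E : Fin n → ElementaryLadder T),
      (Finset.univ : Finset (Fin n)).val.map E = D ∧
      ∃ (c : Coords V fun i => Bar.OptContains (E i).srcBar)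
        (d : Coords U fun i => Bar.OptContains (E i).tgtBar),
        ∀ t x i, Bar.OptContains (E i).tgtBar t →
          d.coord t (Φ.app t x) i = c.coord t x i := by
  constructor
  · rintro ⟨n, E, hE, ⟨e⟩⟩
    refine ⟨n, E, hE, Coords.ofIso e.src fun i => (E i).srcCoord F,
      Coords.ofIso e.tgt fun i => (E i).tgtCoord F, fun t x i ht => ?_⟩
    refine Eq.trans ?_ ((E i).tgtCoord_hom t _ ht)
    exact congrArg _ (congrFun (e.comm t x).symm i)
  · rintro ⟨n, E, hE, c, d, hcd⟩
    refine ⟨n, E, hE, ⟨⟨c.toIso fun i => (E i).srcCoord F, d.toIso fun i => (E i).tgtCoord F, ?_⟩⟩⟩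
    intro t x
    funext i
    change ((E i).toLadder F).hom.app t (((E i).srcCoord F).inv t (c.coord t x i)) =
      ((E i).tgtCoord F).inv t (d.coord t (Φ.app t x) i)
    rw [← ((E i).tgtCoord F).left_inv t (((E i).toLadder F).hom.app t _)]
    congr 1
    by_cases ht : Bar.OptContains (E i).tgtBar t
    · rw [(E i).tgtCoord_hom t _ ht, hcd t x i ht]
      by_cases hs : Bar.OptContains (E i).srcBar t
      · rw [((E i).srcCoord F).right_inv t _ hs]
      · rw [((E i).srcCoord F).support t _ hs, c.support t x i hs]
    · rw [((E i).tgtCoord F).support t _ ht, d.support t _ i ht]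

/-! ### Almost isomorphisms and the closeness of matched bars. -/

/-- The kernel and the cokernel of `Φ` vanish after a shift by `ε`. -/
structure PersModule.Hom.IsAlmostIso {V : PersModule.{u, v} F T} {U : PersModule.{u, w} F T}
    (Φ : Hom V U) (ε : T) : Prop where
  nonneg : 0 ≤ ε
  ker : ∀ {s t : T} (h : s ≤ t), s + ε ≤ t → ∀ x, Φ.app s x = 0 → V.map h x = 0
  coker : ∀ {s t : T} (h : s ≤ t), s + ε ≤ t → ∀ y : U.obj s, ∃ x, Φ.app t x = U.map h y

/-- If `Φ` kills `x`, then so does `Ψ ∘ Φ`, the inner morphism across `2δ`. Every element of the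
target, moved by `2δ`, is the image under `Φ` of its image under `Ψ`. -/
theorem PersModule.IsInterleaving.isAlmostIso {V : PersModule.{u, v} F T}
    {W : PersModule.{u, w} F T} {δ : T} {Φ : Hom V (W.shift δ)} {Ψ : Hom W (V.shift δ)}
    (h : IsInterleaving Φ Ψ) : Φ.IsAlmostIso (δ + δ) := by
  obtain ⟨hδ, h1, h2⟩ := h
  refine ⟨add_nonneg hδ hδ, fun {s t} h ht x hx => ?_, fun {s t} h ht y => ?_⟩
  · have h3 := h1 s x
    have h4 : Ψ.app (s + δ) (Φ.app s x) = 0 := by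
      rw [hx]
      exact map_zero _
    rw [h4] at h3
    rw [← add_assoc] at ht
    rw [← V.map_map (le_add_of_nonneg_right hδ |>.trans (le_add_of_nonneg_right hδ)) ht x, ← h3]
    exact map_zero _
  · rw [← add_assoc] at ht
    refine ⟨V.map ht (Ψ.app (s + δ) y), ?_⟩
    have h3 := h2 (s + δ) y
    refine (Φ.naturality ht _).trans ?_
    refine (congrArg ((W.shift δ).map ht) h3).trans ?_
    exact W.map_map _ _ _

section Diagonal

variable {V : PersModule.{u, v} F T} {U : PersModule.{u, w} F T} {Φ : Hom V U} {ι : Type*}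
  {P Q : ι → T → Prop} {c : Coords V P} {d : Coords U Q} {ε : T}

/-- Otherwise the basis vector `i` at `s` would be in the kernel of `Φ` and yet survive to `t`. -/
theorem PersModule.Hom.IsAlmostIso.target_of_source (hΦ : Φ.IsAlmostIso ε)
    (hcd : ∀ t x i, Q i t → d.coord t (Φ.app t x) i = c.coord t x i) {s t : T} {i : ι}
    (hst : s + ε ≤ t) (hs : P i s) (ht : P i t) : Q i s := by
  classical
  by_contra hQ
  have h : s ≤ t := (le_add_of_nonneg_right hΦ.nonneg).trans hst
  obtain ⟨x, hx⟩ := c.surjective s (Pi.single i 1) fun j hj =>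
    Pi.single_eq_of_ne (by rintro rfl; exact hj hs) 1
  have h0 : Φ.app s x = 0 := by
    rw [d.ext_iff]
    intro j
    rw [map_zero, Pi.zero_apply]
    by_cases hj : Q j s
    · rw [hcd s x j hj, hx]
      exact Pi.single_eq_of_ne (by rintro rfl; exact hQ hj) 1
    · exact d.support s _ j hj
  have h1 := c.natural h x i ht
  rw [hΦ.ker h hst x h0, map_zero, hx, Pi.zero_apply, Pi.single_eq_same] at h1
  exact zero_ne_one h1

/-- The basis vector `i` of the target at `s`, moved to `t`, has a preimage under `Φ`, and the
coordinate `i` of this preimage is 1. -/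
theorem PersModule.Hom.IsAlmostIso.source_of_target (hΦ : Φ.IsAlmostIso ε)
    (hcd : ∀ t x i, Q i t → d.coord t (Φ.app t x) i = c.coord t x i) {s t : T} {i : ι}
    (hst : s + ε ≤ t) (hs : Q i s) (ht : Q i t) : P i t := by
  classical
  by_contra hP
  have h : s ≤ t := (le_add_of_nonneg_right hΦ.nonneg).trans hst
  obtain ⟨y, hy⟩ := d.surjective s (Pi.single i 1) fun j hj =>
    Pi.single_eq_of_ne (by rintro rfl; exact hj hs) 1
  obtain ⟨x, hx⟩ := hΦ.coker h hst y
  have h1 := hcd t x i ht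
  rw [hx, d.natural h y i ht, hy, c.support t x i hP, Pi.single_eq_same] at h1
  exact one_ne_zero h1

end Diagonal

/-- The elementary ladder module has source and target that differ by at most `ε`. -/
def ElementaryLadder.IsClose (ε : T) : ElementaryLadder T → Prop
  | .R J K _ => J.lo ≤ K.lo + ε ∧ J.hi ≤ K.hi + ε
  | .plus J => J.hi < J.lo + ε
  | .minus K => K.hi < K.lo + ε

/-- The two preceding lemmas are tested at extreme indices: at `K.lo` and `K.lo + ε` for the lower
ends, at `J.hi - ε` and `J.hi` for the upper ends, and at the two ends of an unmatched bar. -/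
theorem PersModule.Hom.IsLadderDecomposition.isClose {V : PersModule.{u, v} F T}
    {U : PersModule.{u, w} F T} {Φ : Hom V U} {ε : T} (hΦ : Φ.IsAlmostIso ε)
    {D : Multiset (ElementaryLadder T)} (hD : Φ.IsLadderDecomposition D) :
    ∀ E ∈ D, E.IsClose ε := by
  obtain ⟨n, E, rfl, c, d, hcd⟩ := Hom.isLadderDecomposition_iff.1 hD
  intro E' hE'
  obtain ⟨i, -, rfl⟩ := Multiset.mem_map.1 hE'
  have hε := hΦ.nonneg
  have key1 := fun s t => hΦ.target_of_source (c := c) (d := d) hcd (s := s) (t := t) (i := i)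
  have key2 := fun s t => hΦ.source_of_target (c := c) (d := d) hcd (s := s) (t := t) (i := i)
  cases h : E i with
  | R J K hKJ =>
    simp only [h, ElementaryLadder.srcBar, ElementaryLadder.tgtBar, Bar.optContains_some] at key1 key2
    obtain ⟨o1, o2, o3⟩ := hKJ
    constructor
    · by_contra! hlt
      have := key2 K.lo (K.lo + ε) le_rfl ⟨le_rfl, K.lo_le_hi⟩
        ⟨le_add_of_nonneg_right hε, hlt.le.trans o2⟩
      exact absurd this.1 (not_le.2 hlt)
    · by_contra! hlt
      have hlt' : K.hi < J.hi - ε := lt_sub_iff_add_lt.2 hlt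
      have := key1 (J.hi - ε) J.hi (sub_add_cancel _ _).le
        ⟨o2.trans hlt'.le, sub_le_self _ hε⟩ ⟨J.lo_le_hi, le_rfl⟩
      exact absurd this.2 (not_le.2 hlt')
  | plus J =>
    simp only [h, ElementaryLadder.srcBar, ElementaryLadder.tgtBar, Bar.optContains_some] at key1
    by_contra hlt
    have hlt' : J.lo + ε ≤ J.hi := not_lt.1 hlt
    obtain ⟨_, h, _⟩ := key1 J.lo J.hi hlt' ⟨le_rfl, J.lo_le_hi⟩ ⟨J.lo_le_hi, le_rfl⟩
    cases h
  | minus K =>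
    simp only [h, ElementaryLadder.srcBar, ElementaryLadder.tgtBar, Bar.optContains_some] at key2
    by_contra hlt
    have hlt' : K.lo + ε ≤ K.hi := not_lt.1 hlt
    obtain ⟨_, h, _⟩ := key2 K.lo K.hi hlt' ⟨le_rfl, K.lo_le_hi⟩ ⟨K.lo_le_hi, le_rfl⟩
    cases h

/-! ### The induced matching and its cost. -/

/-- The bar of a summand with zero target. -/
def ElementaryLadder.plusBar : ElementaryLadder T → Option (Bar T)
  | .plus J => some J
  | _ => none

/-- The bar of a summand with zero source. -/
def ElementaryLadder.minusBar : ElementaryLadder T → Option (Bar T)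
  | .minus K => some K
  | _ => none

theorem filterMap_srcBar (δ : T) (D : Multiset (ElementaryLadder T)) :
    D.filterMap ElementaryLadder.srcBar =
      (inducedMatching δ D).map Prod.fst + D.filterMap ElementaryLadder.plusBar := by
  induction D using Multiset.induction with
  | empty => simp [inducedMatching]
  | cons E D ih =>
    rw [inducedMatching] at ih ⊢
    cases E <;> simp [Multiset.filterMap_cons, ElementaryLadder.srcBar, ElementaryLadder.plusBar,
      ElementaryLadder.matchedPair, ih]

theorem map_translate_filterMap_tgtBar (δ : T) (D : Multiset (ElementaryLadder T)) :
    (D.filterMap ElementaryLadder.tgtBar).map (fun K => K.translate δ) =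
      (inducedMatching δ D).map Prod.snd +
        (D.filterMap ElementaryLadder.minusBar).map fun K => K.translate δ := by
  induction D using Multiset.induction with
  | empty => simp [inducedMatching]
  | cons E D ih =>
    rw [inducedMatching] at ih ⊢
    cases E <;> simp [Multiset.filterMap_cons, ElementaryLadder.tgtBar, ElementaryLadder.minusBar,
      ElementaryLadder.matchedPair, ih]

theorem PersModule.Hom.IsLadderDecomposition.barcode_src {V : PersModule.{u, v} F T}
    {U : PersModule.{u, w} F T} {Φ : Hom V U} (hV : V.IsFinitelyIndexed)
    {D : Multiset (ElementaryLadder T)} (hD : Φ.IsLadderDecomposition D) :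
    V.barcode = D.filterMap ElementaryLadder.srcBar := by
  obtain ⟨n, E, rfl, c, -, -⟩ := Hom.isLadderDecomposition_iff.1 hD
  rw [Multiset.filterMap_map]
  exact hV.hasRanks.unique c.hasRanks

theorem PersModule.Hom.IsLadderDecomposition.barcode_tgt {V : PersModule.{u, v} F T}
    {W : PersModule.{u, w} F T} {δ : T} {Φ : Hom V (W.shift δ)} (hW : W.IsFinitelyIndexed)
    {D : Multiset (ElementaryLadder T)} (hD : Φ.IsLadderDecomposition D) :
    W.barcode = (D.filterMap ElementaryLadder.tgtBar).map fun K => K.translate δ := by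
  obtain ⟨n, E, rfl, -, d, -⟩ := Hom.isLadderDecomposition_iff.1 hD
  rw [Multiset.filterMap_map]
  have h : W.barcode.map (fun J => J.translate (-δ)) = _ :=
    (hW.hasRanks.shift δ).unique d.hasRanks
  rw [Function.comp_def, ← h, Multiset.map_map]
  have : ((fun K : Bar T => K.translate δ) ∘ fun J : Bar T => J.translate (-δ)) = id := by
    funext J
    ext <;> simp [Bar.translate]
  rw [this, Multiset.map_id]

section Cost

variable {V : PersModule.{u, v} F T} {W : PersModule.{u, w} F T} {δ : T} {Φ : Hom V (W.shift δ)}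
  {D : Multiset (ElementaryLadder T)}

theorem PersModule.Hom.IsLadderDecomposition.isPartialMatching (hV : V.IsFinitelyIndexed)
    (hW : W.IsFinitelyIndexed) (hD : Φ.IsLadderDecomposition D) :
    IsPartialMatching V.barcode W.barcode (inducedMatching δ D) := by
  rw [hD.barcode_src hV, hD.barcode_tgt hW, filterMap_srcBar δ, map_translate_filterMap_tgtBar]
  exact ⟨Multiset.le_add_right _ _, Multiset.le_add_right _ _⟩

theorem unmatchedCost_le {J : Bar T} (h : J.hi < J.lo + (δ + δ)) :
    unmatchedCost J ≤ ENNReal.ofReal (δ : ℝ) := by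
  have h' : (J.hi : ℝ) < J.lo + (δ + δ) := h
  exact ENNReal.ofReal_le_ofReal (by linarith)

theorem PersModule.Hom.IsLadderDecomposition.matchingCost_le (hV : V.IsFinitelyIndexed)
    (hW : W.IsFinitelyIndexed) (hΦ : Φ.IsAlmostIso (δ + δ)) (hD : Φ.IsLadderDecomposition D) :
    matchingCost V.barcode W.barcode (inducedMatching δ D) ≤ ENNReal.ofReal (δ : ℝ) := by
  classical
  have hclose := hD.isClose hΦ
  rw [matchingCost, hD.barcode_src hV, hD.barcode_tgt hW, filterMap_srcBar δ,
    map_translate_filterMap_tgtBar, add_tsub_cancel_left, add_tsub_cancel_left]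
  refine max_le (Multiset.sup_le.2 fun r hr => ?_) (Multiset.sup_le.2 fun r hr => ?_)
  · obtain ⟨p, hp, rfl⟩ := Multiset.mem_map.1 hr
    obtain ⟨E, hE, hEp⟩ := (Multiset.mem_filterMap _ _).1 hp
    have h := hclose E hE
    cases E with
    | R J K hKJ =>
      cases hEp
      obtain ⟨h1, h2⟩ := h
      obtain ⟨h3, -, h4⟩ := hKJ
      have h1' : (J.lo : ℝ) ≤ K.lo + (δ + δ) := h1
      have h2' : (J.hi : ℝ) ≤ K.hi + (δ + δ) := h2
      have h3' : (K.lo : ℝ) ≤ J.lo := h3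
      have h4' : (K.hi : ℝ) ≤ J.hi := h4
      refine max_le (ENNReal.ofReal_le_ofReal (abs_le.2 ?_))
        (ENNReal.ofReal_le_ofReal (abs_le.2 ?_)) <;>
      · simp only [Bar.translate, AddSubgroup.coe_add]
        constructor <;> linarith
    | plus J => cases hEp
    | minus K => cases hEp
  · obtain ⟨I, hI, rfl⟩ := Multiset.mem_map.1 hr
    rcases Multiset.mem_add.1 hI with hI | hI
    · obtain ⟨E, hE, hEI⟩ := (Multiset.mem_filterMap _ _).1 hI
      have h := hclose E hE
      cases E with
      | plus J => cases hEI; exact unmatchedCost_le h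
      | R J K hKJ => cases hEI
      | minus K => cases hEI
    · obtain ⟨K', hK', rfl⟩ := Multiset.mem_map.1 hI
      obtain ⟨E, hE, hEK⟩ := (Multiset.mem_filterMap _ _).1 hK'
      have h := hclose E hE
      cases E with
      | minus K =>
        cases hEK
        refine unmatchedCost_le ?_
        have h' : K'.hi < K'.lo + (δ + δ) := h
        simp only [Bar.translate]
        rw [add_right_comm]
        gcongr
      | R J K hKJ => cases hEK
      | plus K => cases hEK

end Cost

/-! ### From matchings to interleavings. -/

theorem exists_equiv_of_map_univ_eq {ι κ α : Type*} [Fintype ι] [Fintype κ] (f : ι → α) (g : κ → α)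
    (h : (Finset.univ : Finset ι).val.map f = (Finset.univ : Finset κ).val.map g) :
    ∃ e : ι ≃ κ, ∀ i, g (e i) = f i := by
  classical
  have hcard : ∀ a, Fintype.card {i // f i = a} = Fintype.card {k // g k = a} := by
    intro a
    have h1 := congrArg (Multiset.count a) h
    rw [Multiset.count_map, Multiset.count_map] at h1
    simp only [eq_comm (a := a)] at h1
    rw [Fintype.card_subtype, Fintype.card_subtype]
    exact h1
  exact ⟨Equiv.ofFiberEquiv fun a => Fintype.equivOfCardEq (hcard a), Equiv.ofFiberEquiv_map _⟩

theorem PersModule.IsBarcode.nonempty_coords {V : PersModule.{u, v} F T} {ι : Type*} [Fintype ι]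
    {f : ι → Bar T} (hV : IsBarcode V ((Finset.univ : Finset ι).val.map f)) :
    Nonempty (Coords V fun i => (f i).Contains) := by
  obtain ⟨n, J, hJ, ⟨c⟩⟩ := isBarcode_iff.1 hV
  obtain ⟨e, he⟩ := exists_equiv_of_map_univ_eq f J hJ.symm
  exact ⟨(c.reindex e).congr fun i t => by rw [he]⟩

section Matching

variable {V : PersModule.{u, v} F T} {W : PersModule.{u, w} F T} {α β γ : Type*}
  {J K : α → Bar T} {B : β → Bar T} {C : γ → Bar T} {δ : T}

open scoped Classical in
/-- A matching of the bars of `V` and `W` in which the matched bars are close gives a morphism. -/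
theorem PersModule.Coords.exists_matchingHom (c : Coords V fun i => (Sum.elim J B i).Contains)
    (d : Coords W fun i => (Sum.elim K C i).Contains)
    (hlo : ∀ i, (K i).lo ≤ (J i).lo + δ) (hhi : ∀ i, (K i).hi ≤ (J i).hi + δ) :
    ∃ Φ : Hom V (W.shift δ), ∀ (t : T) (x : V.obj t),
      (∀ i, d.coord (t + δ) (Φ.app t x) (Sum.inl i) =
        if (K i).Contains (t + δ) then c.coord t x (Sum.inl i) else 0) ∧
      ∀ j, d.coord (t + δ) (Φ.app t x) (Sum.inr j) = 0 := by
  obtain ⟨Φ, hΦ⟩ := c.exists_hom (d.shift δ)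
    (fun t => LinearMap.pi (Sum.elim
      (fun i => if (K i).Contains (t + δ) then LinearMap.proj (Sum.inl i) else 0) fun _ => 0))
    (by
      rintro t x (i | j) hk
      · simp [if_neg (show ¬ (K i).Contains (t + δ) from hk)]
      · simp)
    (by
      rintro s t h x (i | j) hk
      · have hk' : (K i).Contains (t + δ) := hk
        simp only [LinearMap.pi_apply, Sum.elim_inl, if_pos hk', LinearMap.proj_apply]
        have hzero : ∀ r, r < (J i).lo → ∀ z : V.obj r, c.coord r z (Sum.inl i) = 0 :=
          fun r hr z => c.support r z _ fun hJ => absurd hJ.1 (not_le.2 hr)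
        by_cases hJ : (J i).lo ≤ t
        · have hJt : (J i).Contains t :=
            ⟨hJ, le_of_add_le_add_right (hk'.2.trans (hhi i))⟩
          rw [c.natural h x (Sum.inl i) hJt]
          split_ifs with hs
          · rfl
          · refine hzero s (lt_of_not_ge fun hJs => hs ⟨?_, ?_⟩) x
            · exact (hlo i).trans (add_le_add_left hJs δ)
            · exact (add_le_add_left h δ).trans hk'.2
        · rw [hzero t (not_le.1 hJ)]
          split_ifs
          · exact (hzero s (h.trans_lt (not_le.1 hJ)) x).symm
          · rfl
      · simp)
  refine ⟨Φ, fun t x => ⟨fun i => ?_, fun j => congrFun (hΦ t x) (Sum.inr j)⟩⟩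
  refine (congrFun (hΦ t x) (Sum.inl i)).trans ?_
  simp only [LinearMap.pi_apply, Sum.elim_inl]
  split_ifs <;> rfl

-- On a matched bar, if `t` and `t + 2δ` lie in `J i`, then the end point inequalities put `t + δ`
-- in `K i`, so the composite through `K i` loses nothing. On an unmatched bar the composite is
-- zero, and so is the inner morphism, since the bar is shorter than `2δ`.
open scoped Classical in
theorem PersModule.Coords.matchingHom_comp (c : Coords V fun i => (Sum.elim J B i).Contains)
    (d : Coords W fun i => (Sum.elim K C i).Contains)
    (hlo : ∀ i, (K i).lo ≤ (J i).lo + δ) (hhi : ∀ i, (J i).hi ≤ (K i).hi + δ)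
    (hB : ∀ j, (B j).hi < (B j).lo + (δ + δ))
    {Φ : Hom V (W.shift δ)} {Ψ : Hom W (V.shift δ)}
    (hΦ : ∀ (t : T) (x : V.obj t) (i : α), d.coord (t + δ) (Φ.app t x) (Sum.inl i) =
      if (K i).Contains (t + δ) then c.coord t x (Sum.inl i) else 0)
    (hΨ : ∀ (t : T) (y : W.obj t),
      (∀ i, c.coord (t + δ) (Ψ.app t y) (Sum.inl i) =
        if (J i).Contains (t + δ) then d.coord t y (Sum.inl i) else 0) ∧
      ∀ j, c.coord (t + δ) (Ψ.app t y) (Sum.inr j) = 0)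
    (t : T) (h : t ≤ t + δ + δ) (x : V.obj t) :
    Ψ.app (t + δ) (Φ.app t x) = V.map h x := by
  refine c.ext_iff.2 ?_
  rintro (i | j)
  · rw [c.coord_map h]
    refine ((hΨ (t + δ) (Φ.app t x)).1 i).trans ?_
    change (if (J i).Contains (t + δ + δ) then _ else _) =
      if (J i).Contains (t + δ + δ) then _ else _
    split_ifs with hJ
    · rw [hΦ t x i]
      split_ifs with hK
      · rfl
      · refine (c.support t x _ fun hJt => hK ⟨?_, ?_⟩).symm
        · exact (hlo i).trans (add_le_add_left hJt.1 δ)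
        · exact le_of_add_le_add_right (hJ.2.trans (hhi i))
    · rfl
  · rw [c.coord_map h]
    refine ((hΨ (t + δ) (Φ.app t x)).2 j).trans ?_
    split_ifs with hb
    · refine (c.support t x _ fun hbt => ?_).symm
      have h1 : (B j).lo + (δ + δ) ≤ t + (δ + δ) := add_le_add_left hbt.1 _
      have h2 : t + δ + δ ≤ (B j).hi := hb.2
      rw [add_assoc] at h2
      exact absurd (h1.trans h2) (not_le.2 (hB j))
    · rfl

theorem PersModule.Coords.exists_interleaving (c : Coords V fun i => (Sum.elim J B i).Contains)
    (d : Coords W fun i => (Sum.elim K C i).Contains) (hδ : 0 ≤ δ)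
    (hlo : ∀ i, (K i).lo ≤ (J i).lo + δ) (hhi : ∀ i, (K i).hi ≤ (J i).hi + δ)
    (hlo' : ∀ i, (J i).lo ≤ (K i).lo + δ) (hhi' : ∀ i, (J i).hi ≤ (K i).hi + δ)
    (hB : ∀ j, (B j).hi < (B j).lo + (δ + δ)) (hC : ∀ j, (C j).hi < (C j).lo + (δ + δ)) :
    ∃ (Φ : Hom V (W.shift δ)) (Ψ : Hom W (V.shift δ)), IsInterleaving Φ Ψ := by
  obtain ⟨Φ, hΦ⟩ := c.exists_matchingHom d hlo hhi
  obtain ⟨Ψ, hΨ⟩ := d.exists_matchingHom c hlo' hhi'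
  exact ⟨Φ, Ψ, hδ,
    fun t x => c.matchingHom_comp d hlo hhi' hB (fun t x => (hΦ t x).1) hΨ t _ x,
    fun t y => d.matchingHom_comp c hlo' hhi hC (fun t y => (hΨ t y).1) hΦ t _ y⟩

end Matching

/-- The strict inequality matters: an unmatched closed bar of length exactly `2δ` has a nonzero
inner morphism across `2δ`. -/
theorem PersModule.interleavingDist_le_of_matchingCost_lt {V : PersModule.{u, v} F T}
    {W : PersModule.{u, w} F T} (hV : V.IsFinitelyIndexed) (hW : W.IsFinitelyIndexed)
    {χ : Multiset (Bar T × Bar T)} (hχ : IsPartialMatching V.barcode W.barcode χ) {δ : T}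
    (hδ : matchingCost V.barcode W.barcode χ < ENNReal.ofReal (δ : ℝ)) :
    interleavingDist V W ≤ ENNReal.ofReal (δ : ℝ) := by
  classical
  have hδ0 : (0 : ℝ) < δ := ENNReal.ofReal_pos.1 (bot_le.trans_lt hδ)
  obtain ⟨B, hB⟩ := Multiset.le_iff_exists_add.1 hχ.1
  obtain ⟨C, hC⟩ := Multiset.le_iff_exists_add.1 hχ.2
  have hV' := hV.isBarcode_barcode
  have hW' := hW.isBarcode_barcode
  rw [matchingCost, hB, hC, add_tsub_cancel_left, add_tsub_cancel_left] at hδ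
  rw [hB] at hV'
  rw [hC] at hW'
  obtain ⟨h1, h2⟩ := max_lt_iff.1 hδ
  have hpair : ∀ p ∈ χ, pairCost p < ENNReal.ofReal (δ : ℝ) := fun p hp =>
    (Multiset.le_sup (Multiset.mem_map_of_mem _ hp)).trans_lt h1
  have hun : ∀ I ∈ B + C, I.hi < I.lo + (δ + δ) := by
    intro I hI
    have := (Multiset.le_sup (Multiset.mem_map_of_mem unmatchedCost hI)).trans_lt h2
    have := (ENNReal.ofReal_lt_ofReal_iff hδ0).1 this
    change (I.hi : ℝ) < I.lo + (δ + δ)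
    linarith
  have hsum : ∀ {α β : Type} [Fintype α] [Fintype β] (f : α → Bar T) (g : β → Bar T),
      (Finset.univ : Finset (α ⊕ β)).val.map (Sum.elim f g) =
        (Finset.univ : Finset α).val.map f + (Finset.univ : Finset β).val.map g := by
    intro α β _ _ f g
    rw [← Finset.univ_disjSum_univ, Finset.val_disjSum, Multiset.disjSum, Multiset.map_add,
      Multiset.map_map, Multiset.map_map]
    rfl
  have hmap : ∀ (f : Bar T × Bar T → Bar T),
      χ.map f = (Finset.univ : Finset χ).val.map fun p : χ => f p.1 :=
    fun f => (Multiset.map_univ χ f).symm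
  rw [hmap, ← Multiset.map_univ_coe B, ← hsum] at hV'
  rw [hmap, ← Multiset.map_univ_coe C, ← hsum] at hW'
  obtain ⟨c⟩ := hV'.nonempty_coords
  obtain ⟨d⟩ := hW'.nonempty_coords
  have hclose : ∀ p : χ, (|((p : Bar T × Bar T).1.lo : ℝ) - (p : Bar T × Bar T).2.lo| < δ) ∧
      |((p : Bar T × Bar T).1.hi : ℝ) - (p : Bar T × Bar T).2.hi| < δ := by
    intro p
    obtain ⟨h1, h2⟩ := max_lt_iff.1 (hpair p Multiset.coe_mem)
    exact ⟨(ENNReal.ofReal_lt_ofReal_iff hδ0).1 h1, (ENNReal.ofReal_lt_ofReal_iff hδ0).1 h2⟩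
  refine iInf₂_le δ (c.exists_interleaving d hδ0.le (fun p => ?_) (fun p => ?_) (fun p => ?_)
    (fun p => ?_) (fun I => hun _ (Multiset.mem_add.2 (Or.inl Multiset.coe_mem)))
    fun I => hun _ (Multiset.mem_add.2 (Or.inr Multiset.coe_mem)))
  all_goals
    obtain ⟨h1, h2⟩ := hclose p
    rw [abs_lt] at h1 h2
    rw [← Subtype.coe_le_coe, AddSubgroup.coe_add]
    linarith

/-- The interleaving distance is at most the bottleneck distance if the indices are dense. -/
theorem PersModule.interleavingDist_le_bottleneckDist {V : PersModule.{u, v} F T}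
    {W : PersModule.{u, w} F T} (hV : V.IsFinitelyIndexed) (hW : W.IsFinitelyIndexed)
    (hT : Dense (T : Set ℝ)) : interleavingDist V W ≤ bottleneckDist V.barcode W.barcode := by
  refine le_iInf₂ fun χ hχ => le_of_forall_gt fun r hr => ?_
  obtain ⟨q, -, hq1, hq2⟩ := ENNReal.lt_iff_exists_real_btwn.1 hr
  obtain ⟨q', -, hq'1, hq'2⟩ := ENNReal.lt_iff_exists_real_btwn.1 hq1
  have hlt : q' < q := (ENNReal.ofReal_lt_ofReal_iff'.1 hq'2).1
  obtain ⟨δ, hδ, h1, h2⟩ := hT.exists_between hlt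
  refine (interleavingDist_le_of_matchingCost_lt hV hW hχ (δ := ⟨δ, hδ⟩) ?_).trans_lt ?_
  · exact hq'1.trans_le (ENNReal.ofReal_le_ofReal h1.le)
  · exact (ENNReal.ofReal_le_ofReal h2.le).trans_lt hq2

/-! ### Matrices of morphisms and admissible changes of coordinates. -/

/-- The componentwise order on bars. -/
def Bar.Le (I J : Bar T) : Prop := I.lo ≤ J.lo ∧ I.hi ≤ J.hi

theorem Bar.Le.trans {I J K : Bar T} (h : I.Le J) (k : J.Le K) : I.Le K :=
  ⟨h.1.trans k.1, h.2.trans k.2⟩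

theorem Bar.Overlaps.le {I J : Bar T} (h : I.Overlaps J) : I.Le J := ⟨h.1, h.2.2⟩

theorem Bar.le_or_nested (I J : Bar T) :
    I.Le J ∨ J.Le I ∨ I.StrictlyNested J ∨ J.StrictlyNested I := by
  rcases le_total I.lo J.lo with h | h <;> rcases le_total I.hi J.hi with k | k
  · exact Or.inl ⟨h, k⟩
  · rcases h.eq_or_lt with h' | h'
    · exact Or.inr (Or.inl ⟨h'.ge, k⟩)
    · rcases k.eq_or_lt with k' | k'
      · exact Or.inl ⟨h, k'.ge⟩
      · exact Or.inr (Or.inr (Or.inr ⟨h', k'⟩))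
  · rcases h.eq_or_lt with h' | h'
    · exact Or.inl ⟨h'.ge, k⟩
    · rcases k.eq_or_lt with k' | k'
      · exact Or.inr (Or.inl ⟨h, k'.ge⟩)
      · exact Or.inr (Or.inr (Or.inl ⟨h', k'⟩))
  · exact Or.inr (Or.inl ⟨h, k⟩)

namespace PersModule

variable {V : PersModule.{u, v} F T} {U : PersModule.{u, w} F T} {ι κ : Type*}
  {J : ι → Bar T} {K : κ → Bar T}

namespace Coords

theorem eq_zero_of_lt (c : Coords V fun i => (J i).Contains) {t : T} {i : ι} (h : t < (J i).lo)
    (x : V.obj t) : c.coord t x i = 0 :=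
  c.support t x i fun hJ => absurd hJ.1 (not_le.2 h)

theorem coord_map_of_le (c : Coords V fun i => (J i).Contains) {s t : T} {i : ι} (h : s ≤ t)
    (ht : t ≤ (J i).hi) (x : V.obj s) : c.coord t (V.map h x) i = c.coord s x i := by
  by_cases hJ : (J i).lo ≤ t
  · exact c.natural h x i ⟨hJ, ht⟩
  · rw [c.eq_zero_of_lt (not_le.1 hJ), c.eq_zero_of_lt (h.trans_lt (not_le.1 hJ))]

theorem exists_coord_eq_single [DecidableEq ι] (c : Coords V fun i => (J i).Contains) {t : T}
    {i : ι} (h : (J i).Contains t) : ∃ x, c.coord t x = Pi.single i 1 :=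
  c.surjective t _ fun j hj => Pi.single_eq_of_ne (by rintro rfl; exact hj h) 1

/-- A change of coordinates by a matrix `1 + N` with `N` of square zero. -/
theorem exists_shear [Fintype ι] (c : Coords V fun i => (J i).Contains) (N : ι → ι → F)
    (hN : ∀ i p, N i p ≠ 0 → (J i).Le (J p)) (hsq : ∀ i p q, N i p * N p q = 0) :
    ∃ c' : Coords V fun i => (J i).Contains, ∀ t x i, t ≤ (J i).hi →
      c'.coord t x i = c.coord t x i + ∑ p, N i p * c.coord t x p := by
  classical
  -- The new coordinate `i` has to be cut off after `(J i).hi`, where a bar `J p` may still be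
  -- alive. No cut is needed before `(J i).lo`, since there the coordinates `p` with `N i p ≠ 0`
  -- vanish as well.
  let A : ∀ t, V.obj t →ₗ[F] (ι → F) := fun t => LinearMap.pi fun i =>
    if t ≤ (J i).hi then LinearMap.proj i ∘ₗ c.coord t +
      ∑ p, N i p • (LinearMap.proj p ∘ₗ c.coord t) else 0
  have hA : ∀ t x i, t ≤ (J i).hi →
      A t x i = c.coord t x i + ∑ p, N i p * c.coord t x p := by
    intro t x i h
    simp [A, h]
  have hterm : ∀ t x i p, t < (J i).lo → N i p * c.coord t x p = 0 := by
    intro t x i p ht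
    by_cases h : N i p = 0
    · rw [h, zero_mul]
    · rw [c.eq_zero_of_lt (ht.trans_le (hN i p h).1), mul_zero]
  refine ⟨⟨A, fun t => ?_, fun t x i h => ?_, fun t g hg => ?_, fun {s t} h x i hi => ?_⟩, hA⟩
  · rw [← LinearMap.ker_eq_bot, LinearMap.ker_eq_bot']
    intro x hx
    have h1 : ∀ i, t ≤ (J i).hi → c.coord t x i = -∑ p, N i p * c.coord t x p := by
      intro i hi
      rw [eq_neg_iff_add_eq_zero, ← hA t x i hi, hx, Pi.zero_apply]
    rw [c.ext_iff]
    intro i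
    rw [map_zero, Pi.zero_apply]
    by_cases hi : t ≤ (J i).hi
    · rw [h1 i hi, neg_eq_zero]
      refine Finset.sum_eq_zero fun p _ => ?_
      by_cases hp : t ≤ (J p).hi
      · rw [h1 p hp, mul_neg, Finset.mul_sum, neg_eq_zero]
        refine Finset.sum_eq_zero fun q _ => ?_
        rw [← mul_assoc, hsq, zero_mul]
      · rw [c.support t x p fun h => hp h.2, mul_zero]
    · exact c.support t x i fun h => hi h.2
  · by_cases ht : t ≤ (J i).hi
    · have hlt : t < (J i).lo := not_le.1 fun hlo => h ⟨hlo, ht⟩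
      rw [hA t x i ht, c.eq_zero_of_lt hlt, zero_add]
      exact Finset.sum_eq_zero fun p _ => hterm t x i p hlt
    · simp [A, ht]
  · obtain ⟨x, hx⟩ := c.surjective t
      (fun i => if t ≤ (J i).hi then g i - ∑ p, N i p * g p else 0) (by
        intro i hi
        by_cases ht : t ≤ (J i).hi
        · rw [if_pos ht, hg i hi, zero_sub, neg_eq_zero]
          refine Finset.sum_eq_zero fun p _ => ?_
          by_cases h : N i p = 0
          · rw [h, zero_mul]
          · rw [hg p fun hp => hi ⟨(hN i p h).1.trans hp.1, ht⟩, mul_zero]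
        · exact if_neg ht)
    refine ⟨x, ?_⟩
    ext i
    by_cases ht : t ≤ (J i).hi
    · rw [hA t x i ht, hx]
      beta_reduce
      rw [if_pos ht]
      have : ∀ p, N i p * (if t ≤ (J p).hi then g p - ∑ q, N p q * g q else 0) = N i p * g p := by
        intro p
        split_ifs with hp
        · rw [mul_sub, Finset.mul_sum, Finset.sum_eq_zero, sub_zero]
          intro q _
          rw [← mul_assoc, hsq, zero_mul]
        · rw [hg p fun h => hp h.2]
      rw [Finset.sum_congr rfl fun p _ => this p, sub_add_cancel]
    · rw [hg i fun h => ht h.2]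
      simp [A, ht]
  · rw [hA t _ i hi.2, hA s x i (h.trans hi.2), c.natural h x i hi]
    congr 1
    refine Finset.sum_congr rfl fun p _ => ?_
    by_cases hp : N i p = 0
    · rw [hp, zero_mul, zero_mul]
    · rw [c.coord_map_of_le h (hi.2.trans (hN i p hp).2)]

/-- Coordinates can be scaled, and extended by coordinates that vanish. -/
theorem exists_extend {I : Type*} (c : Coords V fun i => (J i).Contains)
    (a : I → Option ι) (r : ι → I) (ha : ∀ b i, a b = some i ↔ b = r i) (s : ι → F)
    (hs : ∀ i, s i ≠ 0) :
    ∃ c' : Coords V fun b => Bar.OptContains ((a b).map J),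
      ∀ t x b i, a b = some i → c'.coord t x b = s i * c.coord t x i := by
  let A : ∀ t, V.obj t →ₗ[F] (I → F) := fun t => LinearMap.pi fun b =>
    (a b).elim 0 fun i => s i • (LinearMap.proj i ∘ₗ c.coord t)
  have hA : ∀ t x b i, a b = some i → A t x b = s i * c.coord t x i := by
    intro t x b i h
    simp [A, h]
  have hA0 : ∀ t x b, a b = none → A t x b = 0 := by
    intro t x b h
    simp [A, h]
  have hcon : ∀ t b i, a b = some i → (Bar.OptContains ((a b).map J) t ↔ (J i).Contains t) := by
    intro t b i h
    rw [h]
    exact Bar.optContains_some _ _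
  refine ⟨⟨A, fun t x y h => ?_, fun t x b h => ?_, fun t f hf => ?_, fun {s' t} h x b hb => ?_⟩, hA⟩
  · rw [c.ext_iff]
    intro i
    have h1 := congrFun h (r i)
    rw [hA t x _ i ((ha _ i).2 rfl), hA t y _ i ((ha _ i).2 rfl)] at h1
    exact mul_left_cancel₀ (hs i) h1
  · cases hab : a b with
    | none => exact hA0 t x b hab
    | some i => rw [hA t x b i hab, c.support t x i ((hcon t b i hab).not.1 h), mul_zero]
  · obtain ⟨x, hx⟩ := c.surjective t (fun i => (s i)⁻¹ * f (r i)) (by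
      intro i hi
      rw [hf (r i) ((hcon t (r i) i ((ha _ i).2 rfl)).not.2 hi), mul_zero])
    refine ⟨x, ?_⟩
    ext b
    cases hab : a b with
    | none =>
      rw [hA0 t x b hab, hf b]
      rw [hab]
      simp [Bar.OptContains]
    | some i => rw [hA t x b i hab, hx, mul_inv_cancel_left₀ (hs i), ← (ha b i).1 hab]
  · cases hab : a b with
    | none => rw [hA0 _ _ _ hab, hA0 _ _ _ hab]
    | some i => rw [hA _ _ b i hab, hA _ _ b i hab, c.natural h x i ((hcon t b i hab).1 hb)]

end Coords

/-- The morphism `Φ` has the matrix `φ` in the coordinates `c` and `d`. -/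
structure Hom.HasMatrix [Fintype ι] (Φ : Hom V U) (c : Coords V fun i => (J i).Contains)
    (d : Coords U fun k => (K k).Contains) (φ : κ → ι → F) : Prop where
  overlaps : ∀ k i, φ k i ≠ 0 → (K k).Overlaps (J i)
  coord_app : ∀ t x k, t ≤ (K k).hi →
    d.coord t (Φ.app t x) k = ∑ i, φ k i * c.coord t x i

/-- The entry is the coordinate `k` of the image of the generator of `J i`, taken at its birth;
naturality transports it to all later indices. -/
theorem Hom.exists_hasMatrix [Fintype ι] (Φ : Hom V U) (c : Coords V fun i => (J i).Contains)
    (d : Coords U fun k => (K k).Contains) : ∃ φ, Φ.HasMatrix c d φ := by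
  classical
  choose e he using fun i =>
    c.exists_coord_eq_single (i := i) (t := (J i).lo) ⟨le_rfl, (J i).lo_le_hi⟩
  refine ⟨fun k i => if (K k).Overlaps (J i) then d.coord _ (Φ.app _ (e i)) k else 0,
    fun k i h => ?_, fun t x k hk => ?_⟩
  · by_contra hcon
    exact h (if_neg hcon)
  · by_cases hlo : t < (K k).lo
    · rw [d.eq_zero_of_lt hlo, eq_comm]
      refine Finset.sum_eq_zero fun i _ => ?_
      split_ifs with h
      · rw [c.eq_zero_of_lt (hlo.trans_le h.1), mul_zero]
      · rw [zero_mul]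
    rw [not_lt] at hlo
    -- The default value 0 before the birth of `J i` is harmless: the coordinate that multiplies it
    -- is zero there.
    let b : ∀ i, V.obj t := fun i => if h : (J i).lo ≤ t then V.map h (e i) else 0
    have hx : x = ∑ i, c.coord t x i • b i := by
      rw [c.ext_iff]
      intro j
      rw [map_sum, Finset.sum_apply, Finset.sum_eq_single j]
      · by_cases hj : (J j).Contains t
        · have : b j = V.map hj.1 (e j) := dif_pos hj.1
          rw [map_smul, this, Pi.smul_apply, c.natural hj.1 _ _ hj, he, Pi.single_eq_same,
            smul_eq_mul, mul_one]
        · rw [c.support t x j hj, zero_smul, map_zero, Pi.zero_apply]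
      · intro i _ hij
        by_cases hi : (J i).lo ≤ t
        · have : b i = V.map hi (e i) := dif_pos hi
          rw [map_smul, this, Pi.smul_apply, c.coord_map hi, he, Pi.single_eq_of_ne hij.symm,
            ite_self, smul_zero]
        · rw [c.eq_zero_of_lt (not_le.1 hi), zero_smul, map_zero, Pi.zero_apply]
      · exact fun h => absurd (Finset.mem_univ j) h
    conv_lhs => rw [hx]
    rw [map_sum, map_sum, Finset.sum_apply]
    refine Finset.sum_congr rfl fun i _ => ?_
    rw [map_smul, map_smul, Pi.smul_apply, smul_eq_mul, mul_comm]
    by_cases hi : (J i).Contains t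
    · have hb : b i = V.map hi.1 (e i) := dif_pos hi.1
      congr 1
      rw [hb, Φ.naturality, d.coord_map_of_le hi.1 hk]
      split_ifs with ho
      · rfl
      -- Without overlap, either `J i` ends before `K k` does, and its generator is already zero at
      -- `(K k).hi`, where the coordinate `k` can still be read; or `K k` is not yet born at `(J
      -- i).lo`.
      · by_cases h1 : (K k).lo ≤ (J i).lo
        · have h2 : (J i).hi < (K k).hi := by
            by_contra h2
            exact ho ⟨h1, hi.1.trans hk, not_lt.1 h2⟩
          have h3 : (J i).lo ≤ (K k).hi := hi.1.trans hk
          rw [← d.coord_map_of_le h3 le_rfl, ← Φ.naturality]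
          have h4 : V.map h3 (e i) = 0 := by
            rw [c.ext_iff]
            intro j
            rw [c.coord_map h3, he, map_zero, Pi.zero_apply]
            split_ifs with hj
            · exact Pi.single_eq_of_ne (by rintro rfl; exact absurd hj.2 (not_le.2 h2)) 1
            · rfl
          rw [h4, map_zero, map_zero, Pi.zero_apply]
        · exact d.eq_zero_of_lt (not_le.1 h1) _
    · rw [c.support t x i hi, mul_zero, mul_zero]

/-- An entry that is the only nonzero entry of its row and of its column. -/
def IsIsolated (φ : κ → ι → F) (k : κ) (i : ι) : Prop :=
  φ k i ≠ 0 ∧ (∀ p, φ k p ≠ 0 → p = i) ∧ ∀ q, φ q i ≠ 0 → q = k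

/-- Clearing the row and the column of a pivot. -/
theorem Hom.HasMatrix.exists_clear [Fintype ι] [Fintype κ] {Φ : Hom V U}
    {c : Coords V fun i => (J i).Contains}
    {d : Coords U fun k => (K k).Contains} {φ : κ → ι → F} (h : Φ.HasMatrix c d φ) {k : κ} {i : ι}
    (hki : φ k i ≠ 0) (hrow : ∀ p, φ k p ≠ 0 → (J i).Le (J p))
    (hcol : ∀ q, φ q i ≠ 0 → (K q).Le (K k)) :
    ∃ (c' : Coords V fun i => (J i).Contains) (d' : Coords U fun k => (K k).Contains)
      (φ' : κ → ι → F), Φ.HasMatrix c' d' φ' ∧ IsIsolated φ' k i ∧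
        ∀ q p, IsIsolated φ q p → IsIsolated φ' q p := by
  classical
  obtain ⟨c', hc'⟩ := c.exists_shear
    (fun a p => if a = i ∧ p ≠ i then (φ k i)⁻¹ * φ k p else 0)
    (by
      intro a p hap
      split_ifs at hap with h1
      · exact h1.1 ▸ hrow p (right_ne_zero_of_mul hap)
      · exact absurd rfl hap)
    (by
      intro a p q
      by_cases hp : p = i <;> simp [hp])
  obtain ⟨d', hd'⟩ := d.exists_shear
    (fun q a => if a = k ∧ q ≠ k then -(φ q i * (φ k i)⁻¹) else 0)
    (by
      intro q a hqa
      split_ifs at hqa with h1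
      · exact h1.1 ▸ hcol q (left_ne_zero_of_mul (neg_ne_zero.1 hqa))
      · exact absurd rfl hqa)
    (by
      intro a p q
      by_cases hp : p = k <;> simp [hp])
  have hc1 : ∀ t x p, p ≠ i → t ≤ (J p).hi → c'.coord t x p = c.coord t x p := by
    intro t x p hp ht
    rw [hc' t x p ht]
    simp [hp]
  have hc2 : ∀ t x, t ≤ (J i).hi → φ k i * c'.coord t x i = ∑ p, φ k p * c.coord t x p := by
    intro t x ht
    rw [hc' t x i ht, mul_add, Finset.mul_sum, ← Finset.add_sum_erase _ _ (Finset.mem_univ i),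
      ← Finset.add_sum_erase Finset.univ (fun p => φ k p * c.coord t x p) (Finset.mem_univ i)]
    simp only [ne_eq, not_true_eq_false, and_false, if_false, zero_mul, mul_zero, zero_add,
      true_and]
    congr 1
    refine Finset.sum_congr rfl fun p hp => ?_
    rw [if_pos (Finset.ne_of_mem_erase hp)]
    field_simp
  have hd1 : ∀ t y, t ≤ (K k).hi → d'.coord t y k = d.coord t y k := by
    intro t y ht
    rw [hd' t y k ht]
    simp
  have hd2 : ∀ t y q, q ≠ k → t ≤ (K q).hi →
      d'.coord t y q = d.coord t y q - φ q i * (φ k i)⁻¹ * d.coord t y k := by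
    intro t y q hq ht
    rw [hd' t y q ht, Finset.sum_eq_single k]
    · simp [hq, sub_eq_add_neg]
    · intro a _ ha
      simp [ha]
    · exact fun h => absurd (Finset.mem_univ k) h
  -- By `hcol`, a correction term satisfies `K q ≤ K k ≤ J p` componentwise, so overlap can fail
  -- only because `J p` starts after `K q` ends. The coordinate `p` then vanishes at all relevant
  -- indices, and the entry may be set to zero.
  set φ' : κ → ι → F := fun q p =>
    if q = k then (if p = i then φ k i else 0)
    else if (K q).Overlaps (J p) then φ q p - φ q i * (φ k i)⁻¹ * φ k p else 0 with hφ'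
  have e1 : φ' k i = φ k i := by simp [hφ']
  have e2 : ∀ p, p ≠ i → φ' k p = 0 := fun p hp => by simp [hφ', hp]
  have e3 : ∀ q, q ≠ k → φ' q i = 0 := fun q hq => by simp [hφ', hq, hki]
  have e4 : ∀ q p, q ≠ k → (K q).Overlaps (J p) →
      φ' q p = φ q p - φ q i * (φ k i)⁻¹ * φ k p := fun q p hq ho => by simp [hφ', hq, ho]
  have e5 : ∀ q p, q ≠ k → ¬ (K q).Overlaps (J p) → φ' q p = 0 :=
    fun q p hq ho => by simp [hφ', hq, ho]
  refine ⟨c', d', φ', ⟨fun q p hqp => ?_, fun t x q hq => ?_⟩, ⟨?_, ?_, ?_⟩, ?_⟩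
  · by_cases hq : q = k
    · subst hq
      by_cases hp : p = i
      · subst hp
        exact h.overlaps _ _ hki
      · exact absurd (e2 p hp) hqp
    · by_contra ho
      exact hqp (e5 q p hq ho)
  · by_cases hqk : q = k
    · subst hqk
      rw [hd1 t _ hq, h.coord_app t x q hq, ← hc2 t x (hq.trans (h.overlaps q i hki).2.2), eq_comm,
        Finset.sum_eq_single i, e1]
      · intro p _ hp
        rw [e2 p hp, zero_mul]
      · exact fun h => absurd (Finset.mem_univ i) h
    · rw [hd2 t _ q hqk hq, h.coord_app t x q hq]
      have hk : φ q i * (φ k i)⁻¹ * d.coord t (Φ.app t x) k =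
          φ q i * (φ k i)⁻¹ * ∑ p, φ k p * c.coord t x p := by
        by_cases hqi : φ q i = 0
        · rw [hqi, zero_mul, zero_mul, zero_mul]
        · rw [h.coord_app t x k (hq.trans (hcol q hqi).2)]
      rw [hk, Finset.mul_sum, ← Finset.sum_sub_distrib]
      refine Finset.sum_congr rfl fun p _ => ?_
      by_cases hp : p = i
      · subst hp
        rw [e3 q hqk, zero_mul]
        field_simp
        ring
      · by_cases ho : (K q).Overlaps (J p)
        · rw [e4 q p hqk ho, hc1 t x p hp (hq.trans ho.2.2)]
          ring
        · rw [e5 q p hqk ho, zero_mul]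
          by_cases hlt : t < (J p).lo
          · rw [c.eq_zero_of_lt hlt]
            ring
          · have h1 : φ q p = 0 := by
              by_contra hne
              exact ho (h.overlaps q p hne)
            have h2 : φ q i * φ k p = 0 := by
              by_contra hne
              have h3 := (hcol q (left_ne_zero_of_mul hne)).trans
                ((h.overlaps k p (right_ne_zero_of_mul hne)).le)
              exact ho ⟨h3.1, (not_lt.1 hlt).trans hq, h3.2⟩
            rw [h1]
            linear_combination (-(φ k i)⁻¹ * c.coord t x p) * h2
  · rwa [e1]
  · intro p hp
    by_contra hne
    exact hp (e2 p hne)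
  · intro q hq
    by_contra hne
    exact hq (e3 q hne)
  -- An isolated entry other than the pivot has zeros where its row meets the pivot column and where
  -- its column meets the pivot row, so elimination does not touch its row and column.
  · rintro q p ⟨h1, h2, h3⟩
    by_cases hq : q = k
    · subst hq
      have := h2 i hki
      subst this
      refine ⟨by rwa [e1], fun p hp => ?_, fun q' hq' => ?_⟩
      · by_contra hne
        exact hp (e2 p hne)
      · by_contra hne
        exact hq' (e3 q' hne)
    · have hp : p ≠ i := by
        rintro rfl
        exact hq (h3 k hki).symm
      have hqi : φ q i = 0 := by
        by_contra hne
        exact hp (h2 i hne).symm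
      have hkp : φ k p = 0 := by
        by_contra hne
        exact hq (h3 k hne).symm
      refine ⟨?_, fun p' hp' => ?_, fun q' hq' => ?_⟩
      · rw [e4 q p hq (h.overlaps q p h1), hqi]
        simpa using h1
      · refine h2 p' fun h0 => hp' ?_
        by_cases ho : (K q).Overlaps (J p')
        · rw [e4 q p' hq ho, h0, hqi]
          ring
        · exact e5 q p' hq ho
      · by_cases hqk : q' = k
        · subst hqk
          exact absurd (e2 p hp) hq'
        · refine h3 q' fun h0 => hq' ?_
          by_cases ho : (K q').Overlaps (J p)
          · rw [e4 q' p hqk ho, h0, hkp]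
            ring
          · exact e5 q' p hqk ho

end PersModule

/-! ### Elimination under the nestedness bound. -/

/-- Strictly nested bars of the family have both ends more than `ε` apart. -/
def NestedGap {ι : Type*} (ε : T) (J : ι → Bar T) : Prop :=
  ∀ i p, (J i).StrictlyNested (J p) → (J p).lo + ε < (J i).lo ∧ (J i).hi + ε < (J p).hi

namespace PersModule

variable {V : PersModule.{u, v} F T} {U : PersModule.{u, w} F T} {ι κ : Type*} [Fintype ι]
  {J : ι → Bar T} {K : κ → Bar T} {Φ : Hom V U} {c : Coords V fun i => (J i).Contains}
  {d : Coords U fun k => (K k).Contains} {φ : κ → ι → F} {ε : T}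

/-- The bars of a row of the matrix are directed downwards. -/
theorem Hom.HasMatrix.row_directed (h : Φ.HasMatrix c d φ) (hΦ : Φ.IsAlmostIso ε)
    (hJ : NestedGap ε J) {k : κ} {i p : ι} (hi : φ k i ≠ 0) (hp : φ k p ≠ 0) :
    ∃ r, φ k r ≠ 0 ∧ (J r).Le (J i) ∧ (J r).Le (J p) := by
  classical
  have hε := hΦ.nonneg
  have key : ∀ i p, φ k i ≠ 0 → φ k p ≠ 0 → (J i).StrictlyNested (J p) →
      ∃ r, φ k r ≠ 0 ∧ (J r).Le (J i) ∧ (J r).Le (J p) := by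
    intro i p hi hp hn
    obtain ⟨g1, g2⟩ := hJ i p hn
    obtain ⟨-, o1, o2⟩ := h.overlaps k i hi
    obtain ⟨o3, -, -⟩ := h.overlaps k p hp
    have hlo : (K k).lo + ε < (J i).lo := (add_le_add_left o3 ε).trans_lt g1
    have hle : (K k).lo + ε ≤ (K k).hi := hlo.le.trans o1
    have hst : (K k).lo ≤ (K k).lo + ε := le_add_of_nonneg_right hε
    -- The generator `y` of `K k`, moved by `ε`, lifts to some `x`. The coordinate `k` of the image
    -- of `x` is 1, so some bar `J r` of the row has a nonzero coordinate in `x`. This `r` is the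
    -- required lower bound.
    obtain ⟨y, hy⟩ := d.exists_coord_eq_single (i := k) (t := (K k).lo)
      ⟨le_rfl, (K k).lo_le_hi⟩
    obtain ⟨x, hx⟩ := hΦ.coker hst le_rfl y
    have h1 : ∑ r, φ k r * c.coord _ x r ≠ 0 := by
      rw [← h.coord_app _ x k hle, hx, d.coord_map_of_le hst hle, hy, Pi.single_eq_same]
      exact one_ne_zero
    obtain ⟨r, -, hr⟩ := Finset.exists_ne_zero_of_sum_ne_zero h1
    have hr1 : φ k r ≠ 0 := left_ne_zero_of_mul hr
    have hr2 : c.coord _ x r ≠ 0 := right_ne_zero_of_mul hr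
    have hrlo : (J r).lo ≤ (K k).lo + ε := by
      by_contra hlt
      exact hr2 (c.eq_zero_of_lt (not_le.1 hlt) x)
    -- If `J r` ended later, `x` moved to `(J r).hi - ε` would lie in the kernel of `Φ`, since `y`
    -- has died by then, and yet its coordinate `r` would survive for another `ε`.
    have hrhi : (J r).hi ≤ (K k).hi + ε := by
      by_contra! hlt
      have hlt' : (K k).hi < (J r).hi - ε := lt_sub_iff_add_lt.2 hlt
      have ht : (K k).lo + ε ≤ (J r).hi - ε := hle.trans hlt'.le
      have h0 : Φ.app _ (V.map ht x) = 0 := by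
        rw [Φ.naturality, hx, U.map_map, d.ext_iff]
        intro q
        rw [d.coord_map, hy, map_zero, Pi.zero_apply]
        split_ifs with hq
        · exact Pi.single_eq_of_ne (by rintro rfl; exact absurd hq.2 (not_le.2 hlt')) 1
        · rfl
      have h2 := hΦ.ker (sub_le_self _ hε) (sub_add_cancel _ _).le _ h0
      rw [V.map_map] at h2
      apply hr2
      rw [← c.coord_map_of_le (ht.trans (sub_le_self _ hε)) le_rfl, h2, map_zero, Pi.zero_apply]
    refine ⟨r, hr1, ⟨hrlo.trans hlo.le, ?_⟩, ?_, ?_⟩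
    · by_contra! hlt
      have := (hJ i r ⟨hrlo.trans_lt hlo, hlt⟩).2
      exact absurd (hrhi.trans (add_le_add_left o2 ε)) (not_le.2 this)
    · by_contra! hlt
      have hhi : (J r).hi < (J p).hi := (hrhi.trans (add_le_add_left o2 ε)).trans_lt g2
      have := (hJ r p ⟨hlt, hhi⟩).1
      exact absurd (hrlo.trans (add_le_add_left o3 ε)) (not_le.2 this)
    · exact ((hrhi.trans (add_le_add_left o2 ε)).trans_lt g2).le
  rcases (J i).le_or_nested (J p) with hle | hle | hn | hn
  · exact ⟨i, hi, ⟨le_rfl, le_rfl⟩, hle⟩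
  · exact ⟨p, hp, hle, ⟨le_rfl, le_rfl⟩⟩
  · exact key i p hi hp hn
  · obtain ⟨r, hr, h1, h2⟩ := key p i hp hi hn
    exact ⟨r, hr, h2, h1⟩

/-- The bars of a column of the matrix are directed upwards. -/
theorem Hom.HasMatrix.col_directed [Fintype κ] (h : Φ.HasMatrix c d φ) (hΦ : Φ.IsAlmostIso ε)
    (hK : NestedGap ε K) {k l : κ} {i : ι} (hk : φ k i ≠ 0) (hl : φ l i ≠ 0) :
    ∃ q, φ q i ≠ 0 ∧ (K k).Le (K q) ∧ (K l).Le (K q) := by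
  classical
  have hε := hΦ.nonneg
  have key : ∀ k l, φ k i ≠ 0 → φ l i ≠ 0 → (K k).StrictlyNested (K l) →
      ∃ q, φ q i ≠ 0 ∧ (K k).Le (K q) ∧ (K l).Le (K q) := by
    intro k l hk hl hn
    obtain ⟨g1, g2⟩ := hK k l hn
    obtain ⟨o1, o2, -⟩ := h.overlaps k i hk
    obtain ⟨-, -, o3⟩ := h.overlaps l i hl
    have hhi : (K k).hi + ε < (J i).hi := g2.trans_le o3
    have hlos : (J i).lo ≤ (J i).hi - ε :=
      le_sub_iff_add_le.2 ((add_le_add_left o2 ε).trans hhi.le)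
    have hs : (J i).hi - ε ≤ (J i).hi := sub_le_self _ hε
    obtain ⟨x, hx⟩ := c.exists_coord_eq_single (i := i) (t := (J i).hi - ε) ⟨hlos, hs⟩
    have hΦx : ∀ q, (J i).hi - ε ≤ (K q).hi → d.coord _ (Φ.app _ x) q = φ q i := by
      intro q hq
      rw [h.coord_app _ x q hq, hx, Finset.sum_eq_single i, Pi.single_eq_same, mul_one]
      · intro p _ hp
        rw [Pi.single_eq_of_ne hp, mul_zero]
      · exact fun h => absurd (Finset.mem_univ i) h
    -- Suppose that all bars of the column still alive at `(J i).hi - ε` start more than `ε` before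
    -- `J i`. Then the image of the generator `x` of `J i` already exists as an element `y` at the
    -- last of their births, and `y` lifts to `z` before `J i` is born. The difference of `x` and
    -- `z` is in the kernel of `Φ`, so it dies by `(J i).hi`, although its coordinate `i` is 1.
    obtain ⟨q, hq1, hq2, hq3⟩ : ∃ q, φ q i ≠ 0 ∧ (J i).hi - ε ≤ (K q).hi ∧
        (J i).lo ≤ (K q).lo + ε := by
      by_contra! hcon
      let A : Finset κ := Finset.univ.filter fun q => φ q i ≠ 0 ∧ (J i).hi - ε ≤ (K q).hi
      have hA : ∀ q, q ∈ A ↔ φ q i ≠ 0 ∧ (J i).hi - ε ≤ (K q).hi := fun q => by simp [A]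
      -- Inserting `l` only makes the set nonempty; `K l` also starts more than `ε` before `J i`.
      obtain ⟨m, hm, hmax⟩ := Finset.exists_max_image (insert l A) (fun q => (K q).lo)
        (Finset.insert_nonempty _ _)
      have hmlo : (K m).lo + ε < (J i).lo := by
        rcases Finset.mem_insert.1 hm with rfl | hm
        · exact g1.trans_le o1
        · exact hcon m ((hA m).1 hm).1 ((hA m).1 hm).2
      have hms : (K m).lo ≤ (K m).lo + ε := le_add_of_nonneg_right hε
      obtain ⟨y, hy⟩ := d.surjective (K m).lo (fun q => if q ∈ A then φ q i else 0) (by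
        intro q hq
        refine if_neg fun hqA => hq ⟨hmax q (Finset.mem_insert_of_mem hqA), ?_⟩
        exact (hms.trans hmlo.le).trans (h.overlaps q i ((hA q).1 hqA).1).2.1)
      obtain ⟨z, hz⟩ := hΦ.coker hms le_rfl y
      have hzs : (K m).lo + ε ≤ (J i).hi - ε := hmlo.le.trans hlos
      have h0 : Φ.app _ (x - V.map hzs z) = 0 := by
        rw [map_sub, Φ.naturality, hz, U.map_map, sub_eq_zero, d.ext_iff]
        intro q
        by_cases h1 : (K q).Contains ((J i).hi - ε)
        · rw [hΦx q h1.2, d.natural _ y q h1, hy]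
          beta_reduce
          split_ifs with h2
          · rfl
          · by_contra hne
            exact h2 ((hA q).2 ⟨hne, h1.2⟩)
        · rw [d.support _ _ q h1, d.support _ _ q h1]
      have h1 := hΦ.ker hs (sub_add_cancel _ _).le _ h0
      rw [map_sub, sub_eq_zero, V.map_map] at h1
      have h2 := congrArg (fun a => c.coord _ a i) h1
      simp only [c.coord_map_of_le _ (le_refl (J i).hi), hx, Pi.single_eq_same,
        c.eq_zero_of_lt hmlo] at h2
      exact one_ne_zero h2
    have hqhi : (K k).hi < (K q).hi := (lt_sub_iff_add_lt.2 hhi).trans_le hq2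
    have hqlo : (K l).lo < (K q).lo := by
      have : (K l).lo + ε < (K q).lo + ε := (g1.trans_le o1).trans_le hq3
      exact lt_of_add_lt_add_right this
    refine ⟨q, hq1, ⟨?_, hqhi.le⟩, hqlo.le, ?_⟩
    · by_contra! hlt
      have h1 := (hK k q ⟨hlt, hqhi⟩).1
      exact absurd hq3 (not_le.2 (h1.trans_le o1))
    · by_contra! hlt
      have h1 := (hK q l ⟨hqlo, hlt⟩).2
      exact absurd (sub_le_iff_le_add.1 hq2) (not_le.2 (h1.trans_le o3))
  rcases (K k).le_or_nested (K l) with hle | hle | hn | hn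
  · exact ⟨l, hl, hle, ⟨le_rfl, le_rfl⟩⟩
  · exact ⟨k, hk, ⟨le_rfl, le_rfl⟩, hle⟩
  · exact key k l hk hl hn
  · obtain ⟨r, hr, h1, h2⟩ := key l k hl hk hn
    exact ⟨r, hr, h2, h1⟩

/-- An almost isomorphism between modules with well separated nested bars has, in suitable
coordinates, a matrix with at most one nonzero entry in each row and column. -/
theorem Hom.exists_isolated_matrix [Fintype κ] (hΦ : Φ.IsAlmostIso ε) (hJ : NestedGap ε J)
    (hK : NestedGap ε K) (h : Φ.HasMatrix c d φ) :
    ∃ (c' : Coords V fun i => (J i).Contains) (d' : Coords U fun k => (K k).Contains)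
      (φ' : κ → ι → F), Φ.HasMatrix c' d' φ' ∧ ∀ k i, φ' k i ≠ 0 → IsIsolated φ' k i := by
  classical
  induction hn : Fintype.card (κ × ι) -
    (Finset.univ.filter fun e : κ × ι => IsIsolated φ e.1 e.2).card using Nat.strong_induction_on
    generalizing c d φ with
  | _ n ih =>
  by_cases hiso : ∀ k i, φ k i ≠ 0 → IsIsolated φ k i
  · exact ⟨c, d, φ, h, hiso⟩
  push Not at hiso
  obtain ⟨k₀, i₀, h₀, h₀'⟩ := hiso
  -- Maximal for this order means: target bar as large and source bar as small as possible.
  let f : κ × ι → (T × T) × (T × T)ᵒᵈ :=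
    fun e => (((K e.1).lo, (K e.1).hi), OrderDual.toDual ((J e.2).lo, (J e.2).hi))
  let B : Finset (κ × ι) :=
    Finset.univ.filter fun e => φ e.1 e.2 ≠ 0 ∧ ¬ IsIsolated φ e.1 e.2
  have hB : ∀ q p, (q, p) ∈ B ↔ φ q p ≠ 0 ∧ ¬ IsIsolated φ q p := fun q p => by simp [B]
  obtain ⟨_, hm⟩ := Finset.exists_maximal (s := B.image f)
    ⟨_, Finset.mem_image_of_mem f ((hB k₀ i₀).2 ⟨h₀, h₀'⟩)⟩
  obtain ⟨⟨k, i⟩, hki, rfl⟩ := Finset.mem_image.1 hm.1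
  have hmax : ∀ q p, (q, p) ∈ B → (K k).Le (K q) → (J p).Le (J i) →
      (K q).Le (K k) ∧ (J i).Le (J p) := by
    intro q p hqp h1 h2
    have h3 : f (q, p) ≤ f (k, i) := hm.2 (Finset.mem_image_of_mem f hqp) ⟨h1, h2⟩
    exact ⟨h3.1, h3.2⟩
  obtain ⟨hne, hnot⟩ := (hB k i).1 hki
  -- A lower bound `r` in the row of the pivot is again a non-isolated entry, since an isolated one
  -- would be the pivot itself. Maximality gives `J i ≤ J r`, so the source bar of the pivot is
  -- least in its row. The column is dual.
  obtain ⟨c', d', φ', h', hi', hmono⟩ := h.exists_clear hne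
    (by
      intro p hp
      obtain ⟨r, hr, h1, h2⟩ := h.row_directed hΦ hJ hne hp
      refine (hmax k r ((hB k r).2 ⟨hr, fun his => hnot ?_⟩) ⟨le_rfl, le_rfl⟩ h1).2.trans h2
      exact his.2.1 i hne ▸ his)
    (by
      intro q hq
      obtain ⟨r, hr, h1, h2⟩ := h.col_directed hΦ hK hne hq
      refine h2.trans (hmax r i ((hB r i).2 ⟨hr, fun his => hnot ?_⟩) h1 ⟨le_rfl, le_rfl⟩).1
      exact his.2.2 k hne ▸ his)
  refine ih _ ?_ h' rfl
  -- The number of isolated entries grows: the old ones are kept and the pivot is new.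
  rw [← hn]
  have hlt : (Finset.univ.filter fun e : κ × ι => IsIsolated φ e.1 e.2).card <
      (Finset.univ.filter fun e : κ × ι => IsIsolated φ' e.1 e.2).card := by
    refine Finset.card_lt_card ⟨fun e he => ?_, fun hsub => ?_⟩
    · simp only [Finset.mem_filter, Finset.mem_univ, true_and] at he ⊢
      exact hmono _ _ he
    · have : (k, i) ∈ Finset.univ.filter fun e : κ × ι => IsIsolated φ e.1 e.2 :=
        hsub (by simpa using hi')
      exact hnot (by simpa using this)
  exact Nat.sub_lt_sub_left (hlt.trans_le (Finset.card_le_univ _)) hlt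

/-! ### From a reduced matrix to a ladder decomposition. -/

/-- The nonzero entries, the zero columns and the zero rows of a matrix. -/
abbrev Pieces {α β : Type*} (φ : β → α → F) : Type _ :=
  {e : β × α // φ e.1 e.2 ≠ 0} ⊕ ({i : α // ∀ k, φ k i = 0} ⊕ {k : β // ∀ i, φ k i = 0})

/-- A matrix with at most one nonzero entry in each row and column is a ladder decomposition. -/
theorem Hom.HasMatrix.exists_isLadderDecomposition [Fintype κ] (h : Φ.HasMatrix c d φ)
    (hφ : ∀ k i, φ k i ≠ 0 → IsIsolated φ k i) : ∃ D, Φ.IsLadderDecomposition D := by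
  classical
  let E : Pieces φ → ElementaryLadder T := Sum.elim
    (fun e => .R (J e.1.2) (K e.1.1) (h.overlaps _ _ e.2))
    (Sum.elim (fun i => .plus (J i)) fun k => .minus (K k))
  let a : Pieces φ → Option ι := Sum.elim (fun e => some e.1.2) (Sum.elim (fun i => some i) fun _ => none)
  let a' : Pieces φ → Option κ := Sum.elim (fun e => some e.1.1) (Sum.elim (fun _ => none) fun k => some k)
  have hr : ∀ i, ∃ r : Pieces φ, ∀ b, a b = some i ↔ b = r := by
    intro i
    by_cases hi : ∀ k, φ k i = 0
    · refine ⟨Sum.inr (Sum.inl ⟨i, hi⟩), ?_⟩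
      rintro (⟨⟨k, p⟩, hkp⟩ | ⟨p, hp⟩ | ⟨k, hk⟩)
      · simp only [a, Sum.elim_inl, Option.some.injEq, reduceCtorEq, iff_false]
        rintro rfl
        exact hkp (hi k)
      · simp [a]
      · simp [a]
    · push Not at hi
      obtain ⟨k, hk⟩ := hi
      refine ⟨Sum.inl ⟨(k, i), hk⟩, ?_⟩
      rintro (⟨⟨q, p⟩, hqp⟩ | ⟨p, hp⟩ | ⟨q, hq⟩)
      · simp only [a, Sum.elim_inl, Option.some.injEq, Sum.inl.injEq, Subtype.mk.injEq,
          Prod.mk.injEq]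
        refine ⟨?_, fun h => h.2⟩
        rintro rfl
        exact ⟨(hφ k p hk).2.2 q hqp, rfl⟩
      · simp only [a, Sum.elim_inr, Sum.elim_inl, Option.some.injEq, reduceCtorEq, iff_false]
        rintro rfl
        exact hk (hp k)
      · simp [a]
  have hr' : ∀ k, ∃ r : Pieces φ, ∀ b, a' b = some k ↔ b = r := by
    intro k
    by_cases hk : ∀ i, φ k i = 0
    · refine ⟨Sum.inr (Sum.inr ⟨k, hk⟩), ?_⟩
      rintro (⟨⟨q, i⟩, hqi⟩ | ⟨p, hp⟩ | ⟨q, hq⟩)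
      · simp only [a', Sum.elim_inl, Option.some.injEq, reduceCtorEq, iff_false]
        rintro rfl
        exact hqi (hk i)
      · simp [a']
      · simp [a']
    · push Not at hk
      obtain ⟨i, hi⟩ := hk
      refine ⟨Sum.inl ⟨(k, i), hi⟩, ?_⟩
      rintro (⟨⟨q, p⟩, hqp⟩ | ⟨p, hp⟩ | ⟨q, hq⟩)
      · simp only [a', Sum.elim_inl, Option.some.injEq, Sum.inl.injEq, Subtype.mk.injEq,
          Prod.mk.injEq]
        refine ⟨?_, fun h => h.1⟩
        rintro rfl
        exact ⟨rfl, (hφ q i hi).2.1 p hqp⟩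
      · simp [a']
      · simp only [a', Sum.elim_inr, Option.some.injEq, reduceCtorEq, iff_false]
        rintro rfl
        exact hi (hq i)
  -- The source coordinate is scaled by the nonzero entry of its column, so that the morphism
  -- becomes the identity on each piece.
  have hs : ∀ i, ∃ s : F, s ≠ 0 ∧ ∀ k, φ k i ≠ 0 → φ k i = s := by
    intro i
    by_cases hi : ∀ k, φ k i = 0
    · exact ⟨1, one_ne_zero, fun k hk => absurd (hi k) hk⟩
    · push Not at hi
      obtain ⟨k, hk⟩ := hi
      exact ⟨φ k i, hk, fun q hq => by rw [(hφ k i hk).2.2 q hq]⟩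
  choose r hr using hr
  choose r' hr' using hr'
  choose s hs0 hs using hs
  obtain ⟨c', hc'⟩ := c.exists_extend a r (fun b i => hr i b) s hs0
  obtain ⟨d', hd'⟩ := d.exists_extend a' r' (fun b k => hr' k b) (fun _ => 1)
    fun _ => one_ne_zero
  let e := (Fintype.equivFin (Pieces φ)).symm
  refine ⟨_, Hom.isLadderDecomposition_iff.2 ⟨Fintype.card (Pieces φ), fun j => E (e j), rfl,
    (c'.congr (Q := fun b => Bar.OptContains (E b).srcBar) ?_).reindex e,
    (d'.congr (Q := fun b => Bar.OptContains (E b).tgtBar) ?_).reindex e, ?_⟩⟩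
  · rintro (_ | _ | _) t <;> exact Iff.rfl
  · rintro (_ | _ | _) t <;> exact Iff.rfl
  · intro t x j ht
    change d'.coord t (Φ.app t x) (e j) = c'.coord t x (e j)
    replace ht : Bar.OptContains (E (e j)).tgtBar t := ht
    generalize e j = b at ht ⊢
    rcases b with ⟨⟨k, i⟩, hki⟩ | ⟨i, hi⟩ | ⟨k, hk⟩
    · obtain ⟨K', hK', ht⟩ := ht
      cases hK'
      rw [hd' t _ _ k rfl, hc' t x _ i rfl, one_mul, h.coord_app t x k ht.2,
        Finset.sum_eq_single i, ← hs i k hki]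
      · intro p _ hp
        have : φ k p = 0 := by
          by_contra hne
          exact hp ((hφ k i hki).2.1 p hne)
        rw [this, zero_mul]
      · exact fun h => absurd (Finset.mem_univ i) h
    · obtain ⟨_, hK', -⟩ := ht
      cases hK'
    · obtain ⟨K', hK', ht⟩ := ht
      cases hK'
      rw [hd' t _ _ k rfl, one_mul, h.coord_app t x k ht.2]
      rw [c'.support t x _ (by simp [a, Bar.OptContains])]
      exact Finset.sum_eq_zero fun i _ => by rw [hk i, zero_mul]

/-- Bars of `V` with strict nesting have ends farther apart than any number below the
nestedness. -/
theorem nestedGap_of_lt_nestedness {M : PersModule.{u, v} F T} {α : Type*} [Fintype α]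
    {B : α → Bar T} (hB : M.barcode = (Finset.univ : Finset α).val.map B) {δ : T}
    (hδ : ENNReal.ofReal (δ : ℝ) < M.nestedness / 2) : NestedGap (δ + δ) B := by
  intro i p hn
  have hmem : ∀ j, B j ∈ M.barcode := fun j => by
    rw [hB]
    exact Multiset.mem_map_of_mem B (Finset.mem_univ j)
  have h1 : M.nestedness ≤ min (ENNReal.ofReal |((B i).lo : ℝ) - (B p).lo|)
      (ENNReal.ofReal |((B i).hi : ℝ) - (B p).hi|) :=
    (iInf₂_le (B i) (hmem i)).trans ((iInf₂_le (B p) (hmem p)).trans (iInf_le _ hn))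
  have key : ∀ r : ℝ, M.nestedness ≤ ENNReal.ofReal r → (δ : ℝ) < r / 2 := by
    intro r hr
    have h2 := hδ.trans_le (ENNReal.div_le_div_right hr 2)
    rw [← ENNReal.ofReal_ofNat 2, ← ENNReal.ofReal_div_of_pos two_pos] at h2
    exact (ENNReal.ofReal_lt_ofReal_iff'.1 h2).1
  have hlo : ((B p).lo : ℝ) < (B i).lo := hn.1
  have hhi : ((B i).hi : ℝ) < (B p).hi := hn.2
  have h2 := key _ (h1.trans (min_le_left _ _))
  have h3 := key _ (h1.trans (min_le_right _ _))
  rw [abs_of_pos (by linarith)] at h2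
  rw [abs_of_neg (by linarith)] at h3
  constructor
  · change ((B p).lo : ℝ) + (δ + δ) < (B i).lo
    linarith
  · change ((B i).hi : ℝ) + (δ + δ) < (B p).hi
    linarith

theorem IsInterleaving.exists_isLadderDecomposition {W : PersModule.{u, w} F T}
    (hV : V.IsFinitelyIndexed) (hW : W.IsFinitelyIndexed) {δ : T} {Φ : Hom V (W.shift δ)}
    {Ψ : Hom W (V.shift δ)} (h : IsInterleaving Φ Ψ)
    (hδ : ENNReal.ofReal (δ : ℝ) < min V.nestedness W.nestedness / 2) :
    ∃ D, Φ.IsLadderDecomposition D := by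
  obtain ⟨n, J, hJ, ⟨c⟩⟩ := isBarcode_iff.1 hV.isBarcode_barcode
  obtain ⟨m, K, hK, ⟨d⟩⟩ := isBarcode_iff.1 hW.isBarcode_barcode
  have hJ' := nestedGap_of_lt_nestedness hJ.symm
    (hδ.trans_le (ENNReal.div_le_div_right (min_le_left _ _) 2))
  have hK' := nestedGap_of_lt_nestedness hK.symm
    (hδ.trans_le (ENNReal.div_le_div_right (min_le_right _ _) 2))
  let d' : Coords (W.shift δ) fun k => ((K k).translate (-δ)).Contains :=
    (d.shift δ).congr fun k t => by
      simp [Bar.Contains, Bar.translate, ← sub_eq_add_neg, le_sub_iff_add_le]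
  have hK'' : NestedGap (δ + δ) fun k => (K k).translate (-δ) := by
    intro k q hn
    obtain ⟨h1, h2⟩ := hK' k q ⟨lt_of_add_lt_add_right hn.1, lt_of_add_lt_add_right hn.2⟩
    simp only [Bar.translate]
    rw [add_right_comm, add_right_comm (K k).hi]
    exact ⟨add_lt_add_left h1 _, add_lt_add_left h2 _⟩
  obtain ⟨φ, hφ⟩ := Φ.exists_hasMatrix c d'
  obtain ⟨c', d'', φ', h', hiso⟩ := Hom.exists_isolated_matrix h.isAlmostIso hJ' hK'' hφ
  exact h'.exists_isLadderDecomposition hiso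

end PersModule

theorem mainTheorem4 {F : Type u} [Field F] (T : AddSubgroup ℝ)
    (V : PersModule.{u, v} F T) (W : PersModule.{u, w} F T)
    (hV : V.IsFinitelyIndexed) (hW : W.IsFinitelyIndexed)
    (δ : T) (Φ : PersModule.Hom V (W.shift δ)) (Ψ : PersModule.Hom W (V.shift δ))
    (hΦΨ : PersModule.IsInterleaving Φ Ψ)
    (hδ : ENNReal.ofReal (δ : ℝ) < min V.nestedness W.nestedness / 2) :
    (∃ D : Multiset (ElementaryLadder T), Φ.IsLadderDecomposition D) ∧
    ∀ D : Multiset (ElementaryLadder T), Φ.IsLadderDecomposition D →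
      IsPartialMatching V.barcode W.barcode (inducedMatching δ D) ∧
      matchingCost V.barcode W.barcode (inducedMatching δ D) ≤ ENNReal.ofReal (δ : ℝ) ∧
      (Dense (T : Set ℝ) →
        ENNReal.ofReal (δ : ℝ) = PersModule.interleavingDist V W →
        matchingCost V.barcode W.barcode (inducedMatching δ D) =
          bottleneckDist V.barcode W.barcode) := by
  refine ⟨hΦΨ.exists_isLadderDecomposition hV hW hδ, fun D hD => ?_⟩
  have hmatch := hD.isPartialMatching hV hW
  have hcost := hD.matchingCost_le hV hW hΦΨ.isAlmostIso
  -- The equality closes the chain: bottleneck distance ≤ cost ≤ `δ` = interleaving distance ≤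
  -- bottleneck distance.
  refine ⟨hmatch, hcost, fun hT hdist => le_antisymm ?_ (iInf₂_le _ hmatch)⟩
  exact hcost.trans (hdist.trans_le (interleavingDist_le_bottleneckDist hV hW hT))
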